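/- Let $d\ge 4$ be even and let $(x^\mu)_{\mu=1,\dots,d}$ be coordinates on an open patch $M\subset\mathbb R^d$. Let $\tilde g_{\mu\nu}(x,\rho)$ be a smooth symmetric nondegenerate matrix function (in particular, a smooth $\rho$-dependent family of Lorentzian metrics on $M$) on an open set $W\subset\mathbb R^d\times\mathbb R$, where $M=\{x:(x,0)\in W\}$. Write $'=\partial_\infty=\partial_\rho$, $\partial_\infty^{-1}u(x,\rho)=\int_0^\rho u(x,s)\,ds$, and $u^{[k]}$ for the coefficient of $\rho^k$ in the Taylor expansion of $u$ at $\rho=0$. We say $u=O(\rho^n)$ if $\lim_{\rho\to0}\rho^{-n}u(x,\rho)$ exists for every $x\in M$. Indices are raised and lowered with $\tilde g$; $\tilde\nabla$, $\tilde\Gamma^\mu_{\nu\xi}$ and $\tilde R_{\mu\nu}$ are the Levi-Civita connection, Christoffel symbols and Ricci tensor of $\tilde g(\cdot,\rho)$ at fixed $\rho$. A field with one lower index is treated in these coordinates as a covector field by $\tilde\nabla$. Let $\tilde S_{\mu\nu},\tilde S_{\mu\infty},\tilde S_{\infty\infty}$ be the corresponding components, in the coordinates $(t,x^\mu,\rho)$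 (with $\infty$ denoting the $\rho$ index), of the Ricci tensor of the ambient metric $2\rho\,dt^2+2t\,dt\,d\rho+t^2\tilde g_{\mu\nu}(x,\rho)\,dx^\mu dx^\nu$, $t>0$; they do not depend on $t$, and may be evaluated at $t=1$. Put $\tilde F_\mu=\tilde g^{\xi\chi}(\partial_\xi\tilde g_{\chi\mu}-\tfrac12\partial_\mu\tilde g_{\xi\chi})$ and $$\tilde\gamma=-\tfrac12\tilde g^{[0]\xi\chi}\tilde g^{[1]}_{\xi\chi}+\partial_\infty^{-1}\tilde S_{\infty\infty},\qquad \tilde G_\mu=\tilde F^{[0]}_\mu+2\partial_\infty^{-1}\tilde S_{\mu\infty}-\partial_\mu\partial_\infty^{-1}\tilde\gamma,$$ $$\tilde E_{\mu\nu}=\tilde S_{\mu\nu}-\tfrac12(\tilde\nabla_\mu\tilde G_\nu+\tilde\nabla_\nu\tilde G_\mu)-\tilde g_{\mu\nu}\tilde\gamma .$$ With $\tilde Q^\mu=\partial_\infty(\tilde g^{\nu\xi}\tilde\Gamma^\mu_{\nu\xi})$ and $\tilde g'^{\mu\nu}=\tilde g^{\mu\alpha}\tilde g^{\nu\beta}\tilde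 g'_{\alpha\beta}$, define the following linear differential expressions in $(\tilde G,\tilde\gamma)$: $$\tilde B^1_\mu=-\tfrac12\tilde\nabla^\xi\tilde\nabla_\xi\tilde G_\mu-\tfrac12\tilde R_\mu^{\ \nu}\tilde G_\nu-\left(\tfrac d2-1-\rho\partial_\infty\right)\partial_\infty\tilde G_\mu+\tfrac12\tilde g^{\xi\chi}\tilde g'_{\xi\chi}\,\rho\,\partial_\infty\tilde G_\mu+\tfrac12\rho\,\tilde g^{\xi\chi}\tilde g'_{\xi\chi}\,\partial_\mu\tilde\gamma,$$ $$\tilde B^2=-\tfrac12\tilde\nabla^\mu\partial_\mu\tilde\gamma-\left(\tfrac d2-2-\rho\partial_\infty\right)\partial_\infty\tilde\gamma+\tilde g^{\mu\nu}\tilde g'_{\mu\nu}\,\rho\,\partial_\infty\tilde\gamma-\tfrac12\left(\tilde Q^\mu\tilde G_\mu+\tilde g'^{\mu\nu}\partial_\mu\tilde G_\nu\right)+\tfrac12\tilde g'_{\mu\nu}\tilde\nabla^\mu\tilde G^\nu+\tfrac12\tilde g^{\mu\nu}\tilde g'_{\mu\nu}\,\tilde\gamma .$$ Proposition. If $\tilde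 E_{\mu\nu}=O(\rho^{d/2})$ for all $\mu,\nu$, then $\tilde B^1_\mu=O(\rho^{d/2})$ for all $\mu$, and $\tilde B^2=O(\rho^{d/2-1})$. -/

import Mathlib

open Filter Topology
open scoped ContDiff

noncomputable section

namespace Ambient

/-! ### Coordinate tensor calculus on an open subset of `ι → ℝ` -/

section Coordinates

variable {ι : Type} [Fintype ι] [DecidableEq ι]

/-- The coordinate partial derivative `∂_i f` at `x`. -/
def pd (i : ι) (f : (ι → ℝ) → ℝ) (x : ι → ℝ) : ℝ :=
  fderiv ℝ f x (Pi.single i 1)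

/-- The Christoffel symbol `Γ^k_{ij}` of the Levi-Civita connection of `h`. -/
def christoffel (h : (ι → ℝ) → Matrix ι ι ℝ) (k i j : ι) (x : ι → ℝ) : ℝ :=
  (1 / 2) * ∑ l, (h x)⁻¹ k l *
    (pd i (fun y => h y j l) x + pd j (fun y => h y i l) x - pd l (fun y => h y i j) x)

/-- The Ricci tensor
`R_{ij} = ∂_k Γ^k_{ij} - ∂_j Γ^k_{ik} + Γ^k_{kl} Γ^l_{ij} - Γ^k_{jl} Γ^l_{ik}`. -/
def ricci (h : (ι → ℝ) → Matrix ι ι ℝ) (i j : ι) (x : ι → ℝ) : ℝ :=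
  ∑ k, (pd k (christoffel h k i j) x - pd j (christoffel h k i k) x) +
    ∑ k, ∑ l, (christoffel h k k l x * christoffel h l i j x -
      christoffel h k j l x * christoffel h l i k x)

/-- The covariant derivative `∇_i w_j = ∂_i w_j - Γ^k_{ij} w_k`. -/
def covDeriv (h : (ι → ℝ) → Matrix ι ι ℝ) (w : ι → (ι → ℝ) → ℝ) (i j : ι) (x : ι → ℝ) : ℝ :=
  pd i (w j) x - ∑ k, christoffel h k i j x * w k x

/-- The second covariant derivative `∇_k ∇_i w_j`. -/
def covDeriv₂ (h : (ι → ℝ) → Matrix ι ι ℝ) (w : ι → (ι → ℝ) → ℝ) (k i j : ι)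
    (x : ι → ℝ) : ℝ :=
  pd k (covDeriv h w i j) x - ∑ l, christoffel h l k i x * covDeriv h w l j x -
    ∑ l, christoffel h l k j x * covDeriv h w i l x

/-- `∇^k ∇_k w_j`. -/
def boxForm (h : (ι → ℝ) → Matrix ι ι ℝ) (w : ι → (ι → ℝ) → ℝ) (j : ι) (x : ι → ℝ) : ℝ :=
  ∑ k, ∑ i, (h x)⁻¹ k i * covDeriv₂ h w k i j x

/-- `∇^k ∂_k f`. -/
def boxFun (h : (ι → ℝ) → Matrix ι ι ℝ) (f : (ι → ℝ) → ℝ) (x : ι → ℝ) : ℝ :=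
  ∑ k, ∑ i, (h x)⁻¹ k i * covDeriv h (fun j => pd j f) k i x

end Coordinates

/-! ### Fields on `M × ℝ`, with `M` covered by the coordinates `x : Fin d → ℝ`.
A field has arguments `ρ` (last coordinate) and `x`, in this order, after its indices. -/

variable {d : ℕ}

/-- `u = O(ρ^n)` at the point `x`: the limit of `ρ^{-n} u(x, ρ)` as `ρ → 0` exists. -/
def IsORho (n : ℕ) (u : ℝ → (Fin d → ℝ) → ℝ) (x : Fin d → ℝ) : Prop :=
  ∃ L : ℝ, Tendsto (fun ρ : ℝ => (ρ ^ n)⁻¹ * u ρ x) (𝓝[≠] 0) (𝓝 L)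

/-- `∂_∞ u`, the derivative in `ρ`. -/
def dRho (u : ℝ → (Fin d → ℝ) → ℝ) (ρ : ℝ) (x : Fin d → ℝ) : ℝ :=
  deriv (fun s => u s x) ρ

/-- `∂_∞⁻¹ u`, integration in `ρ` from `0`. -/
def intRho (u : ℝ → (Fin d → ℝ) → ℝ) (ρ : ℝ) (x : Fin d → ℝ) : ℝ :=
  ∫ s in (0 : ℝ)..ρ, u s x

/-- The metric `2 ρ dt² + 2 t dt dρ + t² g_{μν}(x, ρ) dx^μ dx^ν`. The coordinates of a point are
`x^μ` (indices `Sum.inl μ`), `t` (index `Sum.inr 0`) and `ρ` (index `Sum.inr 1`). -/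
def ambientMetric (g : ℝ → (Fin d → ℝ) → Matrix (Fin d) (Fin d) ℝ)
    (y : Fin d ⊕ Fin 2 → ℝ) : Matrix (Fin d ⊕ Fin 2) (Fin d ⊕ Fin 2) ℝ :=
  Matrix.fromBlocks
    ((y (Sum.inr 0)) ^ 2 • g (y (Sum.inr 1)) (fun μ => y (Sum.inl μ))) 0 0
    !![2 * y (Sum.inr 1), y (Sum.inr 0); y (Sum.inr 0), 0]

/-- Components of the Ricci tensor of the ambient metric. The ones used below do not depend on
`t > 0`; they are taken at `t = 1`. -/
def ambientRicci (g : ℝ → (Fin d → ℝ) → Matrix (Fin d) (Fin d) ℝ) (I J : Fin d ⊕ Fin 2)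
    (ρ : ℝ) (x : Fin d → ℝ) : ℝ :=
  ricci (ambientMetric g) I J (Sum.elim x ![1, ρ])

/-- `S_{μν}`. -/
def S (g : ℝ → (Fin d → ℝ) → Matrix (Fin d) (Fin d) ℝ) (μ ν : Fin d) :
    ℝ → (Fin d → ℝ) → ℝ :=
  ambientRicci g (Sum.inl μ) (Sum.inl ν)

/-- `S_{μ∞}`. -/
def Sinf (g : ℝ → (Fin d → ℝ) → Matrix (Fin d) (Fin d) ℝ) (μ : Fin d) :
    ℝ → (Fin d → ℝ) → ℝ :=
  ambientRicci g (Sum.inl μ) (Sum.inr 1)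

/-- `S_{∞∞}`. -/
def Sinfinf (g : ℝ → (Fin d → ℝ) → Matrix (Fin d) (Fin d) ℝ) : ℝ → (Fin d → ℝ) → ℝ :=
  ambientRicci g (Sum.inr 1) (Sum.inr 1)

/-- `g'_{μν} = ∂_∞ g_{μν}`. -/
def gPrime (g : ℝ → (Fin d → ℝ) → Matrix (Fin d) (Fin d) ℝ) (ρ : ℝ) (x : Fin d → ℝ) :
    Matrix (Fin d) (Fin d) ℝ :=
  Matrix.of fun μ ν => dRho (fun s y => g s y μ ν) ρ x

/-- `g^{μν} g'_{μν}`. -/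
def trPrime (g : ℝ → (Fin d → ℝ) → Matrix (Fin d) (Fin d) ℝ) (ρ : ℝ) (x : Fin d → ℝ) : ℝ :=
  ∑ μ, ∑ ν, (g ρ x)⁻¹ μ ν * gPrime g ρ x μ ν

/-- `g'^{μν} = g^{μα} g^{νβ} g'_{αβ}`. -/
def gPrimeUp (g : ℝ → (Fin d → ℝ) → Matrix (Fin d) (Fin d) ℝ) (μ ν : Fin d)
    (ρ : ℝ) (x : Fin d → ℝ) : ℝ :=
  ∑ α, ∑ β, (g ρ x)⁻¹ μ α * (g ρ x)⁻¹ ν β * gPrime g ρ x α β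

/-- `F_μ = g^{ξχ} (∂_ξ g_{χμ} - ½ ∂_μ g_{ξχ})`. -/
def gaugeF (g : ℝ → (Fin d → ℝ) → Matrix (Fin d) (Fin d) ℝ) (μ : Fin d)
    (ρ : ℝ) (x : Fin d → ℝ) : ℝ :=
  ∑ ξ, ∑ χ, (g ρ x)⁻¹ ξ χ *
    (pd ξ (fun y => g ρ y χ μ) x - (1 / 2) * pd μ (fun y => g ρ y ξ χ) x)

/-- `γ = -½ g^{[0]ξχ} g^{[1]}_{ξχ} + ∂_∞⁻¹ S_{∞∞}`. -/
def gaugeGamma (g : ℝ → (Fin d → ℝ) → Matrix (Fin d) (Fin d) ℝ)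
    (ρ : ℝ) (x : Fin d → ℝ) : ℝ :=
  -(1 / 2) * trPrime g 0 x + intRho (Sinfinf g) ρ x

/-- `G_μ = F^{[0]}_μ + 2 ∂_∞⁻¹ S_{μ∞} - ∂_μ ∂_∞⁻¹ γ`. -/
def gaugeG (g : ℝ → (Fin d → ℝ) → Matrix (Fin d) (Fin d) ℝ) (μ : Fin d)
    (ρ : ℝ) (x : Fin d → ℝ) : ℝ :=
  gaugeF g μ 0 x + 2 * intRho (Sinf g μ) ρ x - pd μ (intRho (gaugeGamma g) ρ) x

/-- `E_{μν} = S_{μν} - ½ (∇_μ G_ν + ∇_ν G_μ) - g_{μν} γ`. -/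
def E (g : ℝ → (Fin d → ℝ) → Matrix (Fin d) (Fin d) ℝ) (μ ν : Fin d)
    (ρ : ℝ) (x : Fin d → ℝ) : ℝ :=
  S g μ ν ρ x -
    (1 / 2) * (covDeriv (g ρ) (fun α => gaugeG g α ρ) μ ν x +
      covDeriv (g ρ) (fun α => gaugeG g α ρ) ν μ x) -
    g ρ x μ ν * gaugeGamma g ρ x

/-- `Q^μ = ∂_∞ (g^{νξ} Γ^μ_{νξ})`. -/
def Q (g : ℝ → (Fin d → ℝ) → Matrix (Fin d) (Fin d) ℝ) (μ : Fin d) :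
    ℝ → (Fin d → ℝ) → ℝ :=
  dRho (fun ρ x => ∑ ν, ∑ ξ, (g ρ x)⁻¹ ν ξ * christoffel (g ρ) μ ν ξ x)

/-- The linear operator
`B¹_μ = -½ ∇^ξ ∇_ξ G_μ - ½ R_μ^ν G_ν - (d/2 - 1 - ρ ∂_∞) ∂_∞ G_μ + ½ g^{ξχ} g'_{ξχ} ρ ∂_∞ G_μ
  + ½ ρ g^{ξχ} g'_{ξχ} ∂_μ γ`
in the fields `(G, γ)`. -/
def B₁ (g : ℝ → (Fin d → ℝ) → Matrix (Fin d) (Fin d) ℝ)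
    (G : Fin d → ℝ → (Fin d → ℝ) → ℝ) (γ : ℝ → (Fin d → ℝ) → ℝ) (μ : Fin d)
    (ρ : ℝ) (x : Fin d → ℝ) : ℝ :=
  -(1 / 2) * boxForm (g ρ) (fun α => G α ρ) μ x
    - (1 / 2) * ∑ ν, ∑ ξ, ricci (g ρ) μ ξ x * (g ρ x)⁻¹ ξ ν * G ν ρ x
    - (((d : ℝ) / 2 - 1) * dRho (G μ) ρ x - ρ * dRho (dRho (G μ)) ρ x)
    + (1 / 2) * trPrime g ρ x * ρ * dRho (G μ) ρ x
    + (1 / 2) * ρ * trPrime g ρ x * pd μ (γ ρ) x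

/-- The linear operator
`B² = -½ ∇^μ ∂_μ γ - (d/2 - 2 - ρ ∂_∞) ∂_∞ γ + g^{μν} g'_{μν} ρ ∂_∞ γ
  - ½ (Q^μ G_μ + g'^{μν} ∂_μ G_ν) + ½ g'_{μν} ∇^μ G^ν + ½ g'_{μν} g^{μν} γ`
in the fields `(G, γ)`. The bracket is `∇^μ ∂_∞ G_μ - ∂_∞ ∇^μ G_μ`. -/
def B₂ (g : ℝ → (Fin d → ℝ) → Matrix (Fin d) (Fin d) ℝ)
    (G : Fin d → ℝ → (Fin d → ℝ) → ℝ) (γ : ℝ → (Fin d → ℝ) → ℝ)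
    (ρ : ℝ) (x : Fin d → ℝ) : ℝ :=
  -(1 / 2) * boxFun (g ρ) (γ ρ) x
    - (((d : ℝ) / 2 - 2) * dRho γ ρ x - ρ * dRho (dRho γ) ρ x)
    + trPrime g ρ x * ρ * dRho γ ρ x
    - (1 / 2) * (∑ μ, Q g μ ρ x * G μ ρ x +
        ∑ μ, ∑ ν, gPrimeUp g μ ν ρ x * pd μ (G ν ρ) x)
    + (1 / 2) * ∑ μ, ∑ ν, gPrimeUp g μ ν ρ x * covDeriv (g ρ) (fun α => G α ρ) μ ν x
    + (1 / 2) * trPrime g ρ x * γ ρ x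

end Ambient

end

/-!
The remainder `E` satisfies two exact identities, from which both claims can be read off:

* `B¹_μ = ∇^ν E_{νμ} - ½ ∂_μ (g^{νξ} E_{νξ})`  (`DiffRing.AmbientRing.B1_eq`),
* `B² = -½ ∂_∞ (g^{νξ} E_{νξ}) - ½ g'^{νξ} E_{νξ}`  (`DiffRing.AmbientRing.B2_eq`).

They are the contracted Bianchi identity `∇^I S_{IJ} = ½ ∂_J (tr S)` of the ambient metric. The
components of the ambient Ricci tensor along `t` vanish, because the vector field `t ∂_t` is
homothetic, so the identity only involves `S_{μν}`, `S_{μ∞}` and `S_{∞∞}`. The definitions of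
`E`, `G` and `γ` say that `S_{μν} = E_{μν} + ½ (∇_μ G_ν + ∇_ν G_μ) + g_{μν} γ`,
`S_{μ∞} = ½ (∂_∞ G_μ + ∂_μ γ)` and `S_{∞∞} = ∂_∞ γ`; substituting these, and commuting covariant
derivatives of `G`, turns the identity into the two formulas above. The initial values of `G` and
`γ` at `ρ = 0` matter only in so far as they are smooth.

The tensor calculus is purely algebraic: it takes place over a commutative ring with commuting
derivations `∂_I`, where the curvature is the commutator of the matrix operators `∂_I + A_I` and the
Bianchi identities are identities between matrices (`DiffRing.curv_bianchi`,
`DiffRing.divMixed_ric`). It is applied to the ring of smooth functions of `(x, t, ρ)` on a small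
product domain, and the results are evaluated at `t = 1`.

Finally, a smooth function `u` is `O(ρ^n)` at all points of an open set of `x` if and only if the
derivatives `∂_∞^k u` with `k < n` vanish on `ρ = 0` (`DiffRing.Rep.ord_iff`). This condition is
stable under multiplication by smooth functions and under `∂_μ`, and `∂_∞` lowers `n` by one.
-/

set_option linter.unusedSectionVars false

noncomputable section

namespace DiffRing

/-! ### Riemannian geometry over a commutative ring with commuting derivations -/

section Connection

variable {A : Type*} [CommRing A] [Algebra ℝ A] {ι : Type} [Fintype ι] [DecidableEq ι]

/-- The element `1/2` of a real algebra. -/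
def half (A : Type*) [CommRing A] [Algebra ℝ A] : A := algebraMap ℝ A (1 / 2)

lemma two_mul_half : (2 : A) * half A = 1 := by
  have : (2 : A) = algebraMap ℝ A 2 := (map_ofNat _ 2).symm
  rw [half, this, ← map_mul]; norm_num

@[simp] lemma derivation_half (δ : Derivation ℝ A A) : δ (half A) = 0 :=
  δ.map_algebraMap _

lemma derivation_half_mul (δ : Derivation ℝ A A) (a : A) : δ (half A * a) = half A * δ a := by
  simp

/-- A derivation applied to all entries of a matrix. -/
def dM {m n : Type*} (δ : Derivation ℝ A A) (M : Matrix m n A) : Matrix m n A := M.map δ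

@[simp] lemma dM_apply {m n : Type*} (δ : Derivation ℝ A A) (M : Matrix m n A) (i : m) (j : n) :
    dM δ M i j = δ (M i j) := rfl

lemma dM_add (δ : Derivation ℝ A A) (M N : Matrix ι ι A) : dM δ (M + N) = dM δ M + dM δ N := by
  ext i j; simp

lemma dM_sub (δ : Derivation ℝ A A) (M N : Matrix ι ι A) : dM δ (M - N) = dM δ M - dM δ N := by
  ext i j; simp

lemma dM_neg (δ : Derivation ℝ A A) (M : Matrix ι ι A) : dM δ (-M) = -dM δ M := by
  ext i j; simp

lemma dM_transpose (δ : Derivation ℝ A A) (M : Matrix ι ι A) :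
    dM δ M.transpose = (dM δ M).transpose := rfl

lemma dM_one (δ : Derivation ℝ A A) : dM δ (1 : Matrix ι ι A) = 0 := by
  ext i j
  by_cases h : i = j <;> simp [h]

lemma dM_mul (δ : Derivation ℝ A A) (M N : Matrix ι ι A) :
    dM δ (M * N) = dM δ M * N + M * dM δ N := by
  ext i j
  simp only [dM_apply, Matrix.mul_apply, map_sum, Derivation.leibniz, smul_eq_mul,
    Matrix.add_apply, ← Finset.sum_add_distrib]
  exact Finset.sum_congr rfl fun k _ => by ring

lemma dM_comm {δ ε : Derivation ℝ A A} (h : ∀ a, δ (ε a) = ε (δ a)) (M : Matrix ι ι A) :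
    dM δ (dM ε M) = dM ε (dM δ M) := by
  ext i j; exact h _

/-- The derivative of an inverse matrix. -/
lemma dM_inverse (δ : Derivation ℝ A A) {g gi : Matrix ι ι A} (h : gi * g = 1) :
    dM δ gi = -(gi * dM δ g * gi) := by
  have h' : g * gi = 1 := mul_eq_one_comm.mp h
  have e : dM δ gi * g + gi * dM δ g = 0 := by rw [← dM_mul, h, dM_one]
  calc dM δ gi = (dM δ gi * g) * gi := by rw [mul_assoc, h', mul_one]
    _ = -(gi * dM δ g * gi) := by rw [eq_neg_of_add_eq_zero_left e, neg_mul]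

variable (D : ι → Derivation ℝ A A)

/-- The Christoffel symbols `Γ^k_{ij}` of the metric `g` with inverse `gi`. -/
def chr (g gi : Matrix ι ι A) (k i j : ι) : A :=
  half A * ∑ l, gi k l * (D i (g j l) + D j (g i l) - D l (g i j))

/-- The Ricci tensor of a connection with symbols `Γ k i j = Γ^k_{ij}`. -/
def ric (Γ : ι → ι → ι → A) (i j : ι) : A :=
  ∑ k, (D k (Γ k i j) - D j (Γ k i k)) + ∑ k, ∑ l, (Γ k k l * Γ l i j - Γ k j l * Γ l i k)

/-- The covariant derivative `∇_i w_j`. -/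
def cov (Γ : ι → ι → ι → A) (w : ι → A) (i j : ι) : A :=
  D i (w j) - ∑ k, Γ k i j * w k

/-- The covariant derivative `∇_k T_{ij}`; the direction `k` comes first. -/
def covT (Γ : ι → ι → ι → A) (T : ι → ι → A) (k i j : ι) : A :=
  D k (T i j) - ∑ l, Γ l k i * T l j - ∑ l, Γ l k j * T i l

/-- The divergence `∇_j T^j_i` of a tensor of mixed type. -/
def divMixed (Γ : ι → ι → ι → A) (T : ι → ι → A) (i : ι) : A :=
  ∑ j, D j (T j i) + ∑ j, ∑ m, Γ j j m * T m i - ∑ j, ∑ m, Γ m j i * T j m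

/-- The connection matrix `(Γ^k_{ij})_{k,j}` in the direction `i`. -/
def conn (Γ : ι → ι → ι → A) (i : ι) : Matrix ι ι A := Matrix.of fun k j => Γ k i j

@[simp] lemma conn_apply (Γ : ι → ι → ι → A) (i k j : ι) : conn Γ i k j = Γ k i j := rfl

/-- The curvature `F_{ij} = [∂_i + A_i, ∂_j + A_j]`, an endomorphism for each pair `i, j`. -/
def curv (Γ : ι → ι → ι → A) (i j : ι) : Matrix ι ι A :=
  dM (D i) (conn Γ j) - dM (D j) (conn Γ i) + conn Γ i * conn Γ j - conn Γ j * conn Γ i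

variable {D} {Γ : ι → ι → ι → A} {g gi : Matrix ι ι A}

lemma curv_apply (i j k l : ι) :
    curv D Γ i j k l = D i (Γ k j l) - D j (Γ k i l) + ∑ m, Γ k i m * Γ m j l
      - ∑ m, Γ k j m * Γ m i l := by
  simp [curv, Matrix.mul_apply]

lemma curv_swap (i j : ι) : curv D Γ j i = -curv D Γ i j := by
  rw [curv, curv]; abel

lemma ric_eq_sum_curv (hΓ : ∀ k i j, Γ k i j = Γ k j i) (i j : ι) :
    ric D Γ i j = ∑ k, curv D Γ k j k i := by
  simp only [ric, curv_apply, ← Finset.sum_add_distrib]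
  refine Finset.sum_congr rfl fun k _ => ?_
  rw [hΓ k i j, hΓ k i k, Finset.sum_sub_distrib,
    Finset.sum_congr rfl fun l _ => congrArg (Γ k k l * ·) (hΓ l i j),
    Finset.sum_congr rfl fun l _ => congrArg (Γ k j l * ·) (hΓ l i k)]
  ring

/-- The algebraic Bianchi identity. -/
lemma curv_cyclic (hΓ : ∀ k i j, Γ k i j = Γ k j i) (i j l k : ι) :
    curv D Γ i j k l + curv D Γ j l k i + curv D Γ l i k j = 0 := by
  simp only [curv_apply]
  simp only [hΓ _ j i, hΓ _ l i, hΓ _ l j]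
  ring

/-- The differential Bianchi identity, as the Jacobi identity for the operators `∂_i + A_i`. The
Christoffel terms acting on the indices `i, j, k` cancel in the cyclic sum and are left out. -/
lemma curv_bianchi (hD : ∀ i j a, D i (D j a) = D j (D i a)) (i j k : ι) :
    (dM (D i) (curv D Γ j k) + conn Γ i * curv D Γ j k - curv D Γ j k * conn Γ i)
      + (dM (D j) (curv D Γ k i) + conn Γ j * curv D Γ k i - curv D Γ k i * conn Γ j)
      + (dM (D k) (curv D Γ i j) + conn Γ k * curv D Γ i j - curv D Γ i j * conn Γ k) = 0 := by
  simp only [curv, dM_add, dM_sub, dM_mul]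
  rw [dM_comm (hD j i), dM_comm (hD k i), dM_comm (hD k j)]
  noncomm_ring

/-- Compatibility of the symbols `Γ` with the inverse metric `gi`: `∇_i g^{kl} = 0`, in matrix
form. -/
def InvCompat (D : ι → Derivation ℝ A A) (Γ : ι → ι → ι → A) (gi : Matrix ι ι A) : Prop :=
  ∀ i, dM (D i) gi = -(conn Γ i * gi) - gi * (conn Γ i).transpose

/-- Metric compatibility makes `F_{ij} g^{-1}` antisymmetric: this is the statement that the mixed
second derivatives of `g^{-1}` commute. -/
lemma curv_mul_antisymm (hD : ∀ i j a, D i (D j a) = D j (D i a)) (hc : InvCompat D Γ gi)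
    (hs : gi.transpose = gi) (i j : ι) :
    (curv D Γ i j * gi).transpose = -(curv D Γ i j * gi) := by
  have h := dM_comm (hD i j) gi
  rw [hc i, hc j] at h
  simp only [dM_sub, dM_neg, dM_mul, dM_transpose] at h
  rw [hc i, hc j] at h
  rw [Matrix.transpose_mul, hs, eq_neg_iff_add_eq_zero]
  simp only [curv, Matrix.transpose_sub, Matrix.transpose_add, Matrix.transpose_mul]
  rw [← sub_eq_zero] at h
  rw [← neg_eq_zero, ← h]
  noncomm_ring

/-- The differential Bianchi identity for the curvature `F g^{-1}` with both indices raised. -/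
lemma curv_mul_bianchi (hD : ∀ i j a, D i (D j a) = D j (D i a)) (hc : InvCompat D Γ gi)
    (i j k : ι) :
    (dM (D i) (curv D Γ j k * gi) + conn Γ i * (curv D Γ j k * gi)
        + curv D Γ j k * gi * (conn Γ i).transpose)
      + (dM (D j) (curv D Γ k i * gi) + conn Γ j * (curv D Γ k i * gi)
        + curv D Γ k i * gi * (conn Γ j).transpose)
      + (dM (D k) (curv D Γ i j * gi) + conn Γ k * (curv D Γ i j * gi)
        + curv D Γ i j * gi * (conn Γ k).transpose) = 0 := by
  have h := congrArg (· * gi) (curv_bianchi (Γ := Γ) hD i j k)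
  simp only [zero_mul] at h
  rw [← h]
  simp only [dM_mul, hc _]
  noncomm_ring

/-- The mixed Ricci tensor is a contraction of `F g^{-1}`. -/
lemma mul_ric_apply (hΓ : ∀ k i j, Γ k i j = Γ k j i) (hs : gi.transpose = gi) (l j : ι) :
    (gi * Matrix.of (ric D Γ)) l j = ∑ k, (curv D Γ k j * gi) k l := by
  have hs' : ∀ a b, gi a b = gi b a := fun a b => congrFun (congrFun hs b) a
  simp only [Matrix.mul_apply, Matrix.of_apply, ric_eq_sum_curv hΓ, Finset.mul_sum]
  rw [Finset.sum_comm]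
  refine Finset.sum_congr rfl fun k _ => Finset.sum_congr rfl fun i _ => ?_
  rw [hs' l i, mul_comm]

/-- A double sum of a symmetric against an antisymmetric array vanishes. -/
lemma sum_symm_mul_antisymm {s a : ι → ι → A} (h1 : ∀ i j, s i j = s j i)
    (h2 : ∀ i j, a i j = -a j i) : ∑ i, ∑ j, s i j * a i j = 0 := by
  have h : ∑ i, ∑ j, s i j * a i j = -∑ i, ∑ j, s i j * a i j := by
    conv_lhs => rw [Finset.sum_comm]
    simp only [← Finset.sum_neg_distrib]
    refine Finset.sum_congr rfl fun i _ => Finset.sum_congr rfl fun j _ => ?_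
    rw [h1, h2]; ring
  have h' : 2 * ∑ i, ∑ j, s i j * a i j = 0 := by linear_combination h
  linear_combination half A * h' - (∑ i, ∑ j, s i j * a i j) * two_mul_half (A := A)

/-- The Ricci tensor of a metric connection is symmetric: by the algebraic Bianchi identity its
antisymmetric part is the trace of `F_{ij}`, which vanishes since `F_{ij} g^{-1}` is
antisymmetric. -/
lemma ric_symm (hD : ∀ i j a, D i (D j a) = D j (D i a)) (hΓ : ∀ k i j, Γ k i j = Γ k j i)
    (hc : InvCompat D Γ gi) (hs : gi.transpose = gi) (hgs : g.transpose = g) (hg : gi * g = 1)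
    (i j : ι) : ric D Γ i j = ric D Γ j i := by
  have hs' : ∀ a b, g a b = g b a := fun a b => congrFun (congrFun hgs b) a
  have ha := curv_mul_antisymm hD hc hs j i
  have htr : ∑ k, curv D Γ j i k k = 0 := by
    have e : curv D Γ j i = (curv D Γ j i * gi) * g := by rw [mul_assoc, hg, mul_one]
    rw [e]
    simp only [Matrix.mul_apply (M := curv D Γ j i * gi)]
    rw [← sum_symm_mul_antisymm (s := fun a b => g a b)
      (a := fun a b => (curv D Γ j i * gi) a b) hs' fun a b => congrFun (congrFun ha b) a]
    refine Finset.sum_congr rfl fun a _ => Finset.sum_congr rfl fun b _ => ?_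
    rw [hs' a b, mul_comm]
  rw [ric_eq_sum_curv hΓ, ric_eq_sum_curv hΓ, ← sub_eq_zero, ← Finset.sum_sub_distrib,
    ← neg_eq_zero, ← Finset.sum_neg_distrib, ← htr]
  refine Finset.sum_congr rfl fun k _ => ?_
  have h := curv_cyclic (D := D) hΓ k j i k
  rw [curv_swap k i, Matrix.neg_apply] at h
  linear_combination -h

/-- The contracted Bianchi identity `∇_j R^j_i = ½ ∂_i R`, for the Ricci tensor with its first
index raised. -/
theorem divMixed_ric (hD : ∀ i j a, D i (D j a) = D j (D i a)) (hΓ : ∀ k i j, Γ k i j = Γ k j i)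
    (hc : InvCompat D Γ gi) (hs : gi.transpose = gi) (i : ι) :
    divMixed D Γ (gi * Matrix.of (ric D Γ)) i =
      half A * D i (∑ j, (gi * Matrix.of (ric D Γ)) j j) := by
  set P : ι → ι → Matrix ι ι A := fun a b => curv D Γ a b * gi with hP
  have ha : ∀ a b k l, P a b k l = -P a b l k := fun a b k l =>
    congrFun (congrFun (curv_mul_antisymm hD hc hs a b) l) k
  have hsw : ∀ a b k l, P a b k l = -P b a k l := fun a b k l => by
    simp only [hP, curv_swap b a, neg_mul, Matrix.neg_apply]
  have hT : ∀ l j, (gi * Matrix.of (ric D Γ)) l j = ∑ k, P k j k l := mul_ric_apply hΓ hs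
  -- the differential Bianchi identity with both upper indices contracted
  have hB : ∑ j, ∑ k, ((D i (P j k j k) + ∑ m, Γ j i m * P j k m k + ∑ m, P j k j m * Γ k i m)
      + (D j (P k i j k) + ∑ m, Γ j j m * P k i m k + ∑ m, P k i j m * Γ k j m)
      + (D k (P i j j k) + ∑ m, Γ j k m * P i j m k + ∑ m, P i j j m * Γ k k m)) = 0 := by
    refine Finset.sum_eq_zero fun j _ => Finset.sum_eq_zero fun k _ => ?_
    simpa [Matrix.mul_apply (M := conn Γ _), Matrix.mul_apply (N := (conn Γ _).transpose)]
      using congrFun (congrFun (curv_mul_bianchi (Γ := Γ) hD hc i j k) j) k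
  simp only [Finset.sum_add_distrib] at hB
  -- The nine contractions are expressed through `R^l_j = ∑ k, P k j k l`; two of them pair the
  -- symmetric lower indices of `Γ` with the antisymmetric indices of `P` and vanish.
  have e1 : ∑ j, ∑ k, D i (P j k j k) = D i (∑ j, ∑ k, P k j k j) := by
    rw [Finset.sum_comm]; simp only [map_sum]
  have e2 : ∑ j, ∑ k, ∑ m, Γ j i m * P j k m k = ∑ j, ∑ m, Γ m j i * ∑ k, P k m k j := by
    conv_rhs => rw [Finset.sum_comm]
    refine Finset.sum_congr rfl fun j _ => ?_
    rw [Finset.sum_comm]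
    refine Finset.sum_congr rfl fun m _ => ?_
    rw [Finset.mul_sum]
    refine Finset.sum_congr rfl fun k _ => ?_
    rw [hΓ j i m, ha j k, hsw j k, neg_neg]
  have e3 : ∑ j, ∑ k, ∑ m, P j k j m * Γ k i m = ∑ j, ∑ m, Γ m j i * ∑ k, P k m k j := by
    rw [Finset.sum_comm]
    conv_rhs => rw [Finset.sum_comm]
    refine Finset.sum_congr rfl fun j _ => ?_
    rw [Finset.sum_comm]
    refine Finset.sum_congr rfl fun m _ => ?_
    rw [Finset.mul_sum]
    refine Finset.sum_congr rfl fun k _ => ?_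
    rw [hΓ j i m, mul_comm]
  have e4 : ∑ j, ∑ k, D j (P k i j k) = -∑ j, D j (∑ k, P k i k j) := by
    simp only [map_sum, ← Finset.sum_neg_distrib]
    refine Finset.sum_congr rfl fun j _ => Finset.sum_congr rfl fun k _ => ?_
    rw [ha, map_neg]
  have e5 : ∑ j, ∑ k, ∑ m, Γ j j m * P k i m k = -∑ j, ∑ m, Γ j j m * ∑ k, P k i k m := by
    simp only [← Finset.sum_neg_distrib]
    refine Finset.sum_congr rfl fun j _ => ?_
    rw [Finset.sum_comm]
    refine Finset.sum_congr rfl fun m _ => ?_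
    rw [← mul_neg, ← Finset.sum_neg_distrib, Finset.mul_sum]
    exact Finset.sum_congr rfl fun k _ => by rw [ha]
  have e6 : ∑ j, ∑ k, ∑ m, P k i j m * Γ k j m = 0 := by
    rw [Finset.sum_comm]
    refine Finset.sum_eq_zero fun k _ => ?_
    rw [← sum_symm_mul_antisymm (s := fun j m => Γ k j m) (a := fun j m => P k i j m) (hΓ k)
      (ha k i)]
    exact Finset.sum_congr rfl fun j _ => Finset.sum_congr rfl fun m _ => mul_comm _ _
  have e7 : ∑ j, ∑ k, D k (P i j j k) = -∑ j, D j (∑ k, P k i k j) := by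
    rw [Finset.sum_comm]
    simp only [map_sum, ← Finset.sum_neg_distrib]
    refine Finset.sum_congr rfl fun j _ => Finset.sum_congr rfl fun k _ => ?_
    rw [hsw, map_neg]
  have e8 : ∑ j, ∑ k, ∑ m, Γ j k m * P i j m k = 0 :=
    Finset.sum_eq_zero fun j _ =>
      sum_symm_mul_antisymm (s := fun k m => Γ j k m) (a := fun k m => P i j m k) (hΓ j)
        fun k m => ha i j m k
  have e9 : ∑ j, ∑ k, ∑ m, P i j j m * Γ k k m = -∑ j, ∑ m, Γ j j m * ∑ k, P k i k m := by
    rw [Finset.sum_comm]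
    simp only [← Finset.sum_neg_distrib]
    refine Finset.sum_congr rfl fun j _ => ?_
    rw [Finset.sum_comm]
    refine Finset.sum_congr rfl fun m _ => ?_
    rw [← mul_neg, ← Finset.sum_neg_distrib, Finset.mul_sum]
    exact Finset.sum_congr rfl fun k _ => by rw [hsw, mul_comm]
  rw [e1, e2, e3, e4, e5, e6, e7, e8, e9] at hB
  simp only [divMixed, hT]
  linear_combination (-half A) * hB +
    (∑ j, D j (∑ k, P k i k j) + ∑ j, ∑ m, Γ j j m * ∑ k, P k i k m
      - ∑ j, ∑ m, Γ m j i * ∑ k, P k m k j) * (-two_mul_half (A := A))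

/-! #### Divergences and commutation of covariant derivatives -/

lemma InvCompat.apply (hc : InvCompat D Γ gi) (i a b : ι) :
    D i (gi a b) = -∑ m, Γ a i m * gi m b - ∑ m, gi a m * Γ b i m := by
  have := congrFun (congrFun (hc i) a) b
  simpa [Matrix.mul_apply] using this

/-- Contraction with the inverse metric commutes with the covariant derivative. -/
lemma sum_mul_covT (hc : InvCompat D Γ gi) (T : ι → ι → A) (i : ι) :
    ∑ k, ∑ l, gi k l * covT D Γ T i k l = D i (∑ k, ∑ l, gi k l * T k l) := by
  have hl : ∑ k, ∑ l, (∑ m, Γ k i m * gi m l) * T k l =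
      ∑ k, ∑ l, gi k l * ∑ m, Γ m i k * T m l := by
    rw [Finset.sum_comm]
    conv_rhs => rw [Finset.sum_comm]
    refine Finset.sum_congr rfl fun l _ => ?_
    simp only [Finset.sum_mul, Finset.mul_sum]
    rw [Finset.sum_comm]
    exact Finset.sum_congr rfl fun m _ => Finset.sum_congr rfl fun k _ => by ring
  have hr : ∑ k, ∑ l, (∑ m, gi k m * Γ l i m) * T k l =
      ∑ k, ∑ l, gi k l * ∑ m, Γ m i l * T k m := by
    refine Finset.sum_congr rfl fun k _ => ?_
    simp only [Finset.sum_mul, Finset.mul_sum]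
    rw [Finset.sum_comm]
    exact Finset.sum_congr rfl fun m _ => Finset.sum_congr rfl fun l _ => by ring
  simp only [map_sum, Derivation.leibniz, smul_eq_mul, hc.apply, covT]
  have e : ∀ k l, gi k l * D i (T k l) + T k l * (-∑ m, Γ k i m * gi m l - ∑ m, gi k m * Γ l i m)
      = gi k l * D i (T k l) - (∑ m, Γ k i m * gi m l) * T k l
        - (∑ m, gi k m * Γ l i m) * T k l := fun k l => by ring
  simp only [e]
  simp only [mul_sub, Finset.sum_sub_distrib, hl, hr]

/-- The divergence of a vector field with its index raised. -/
lemma div_raise (hc : InvCompat D Γ gi) (w : ι → A) :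
    ∑ j, D j (∑ l, gi j l * w l) + ∑ j, ∑ m, Γ j j m * ∑ l, gi m l * w l =
      ∑ k, ∑ l, gi k l * cov D Γ w k l := by
  have h1 : ∑ j, ∑ l, (∑ m, Γ j j m * gi m l) * w l = ∑ j, ∑ m, Γ j j m * ∑ l, gi m l * w l := by
    refine Finset.sum_congr rfl fun j _ => ?_
    simp only [Finset.sum_mul, Finset.mul_sum]
    rw [Finset.sum_comm]
    exact Finset.sum_congr rfl fun m _ => Finset.sum_congr rfl fun l _ => by ring
  have h2 : ∑ j, ∑ l, (∑ m, gi j m * Γ l j m) * w l = ∑ k, ∑ l, gi k l * ∑ m, Γ m k l * w m := by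
    refine Finset.sum_congr rfl fun j _ => ?_
    simp only [Finset.sum_mul, Finset.mul_sum]
    rw [Finset.sum_comm]
    exact Finset.sum_congr rfl fun m _ => Finset.sum_congr rfl fun l _ => by ring
  simp only [map_sum, Derivation.leibniz, smul_eq_mul, hc.apply, cov]
  have e : ∀ j l, gi j l * D j (w l) + w l * (-∑ m, Γ j j m * gi m l - ∑ m, gi j m * Γ l j m)
      = gi j l * D j (w l) - (∑ m, Γ j j m * gi m l) * w l
        - (∑ m, gi j m * Γ l j m) * w l := fun j l => by ring
  simp only [e]
  simp only [mul_sub, Finset.sum_sub_distrib, h1, h2]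
  ring

/-- The divergence of a tensor with its first index raised. -/
lemma divMixed_raise (hc : InvCompat D Γ gi) (T : ι → ι → A) (i : ι) :
    divMixed D Γ (fun j a => ∑ l, gi j l * T l a) i =
      ∑ k, ∑ l, gi k l * covT D Γ T k l i := by
  have h := div_raise hc (fun l => T l i)
  have h3 : ∑ j, ∑ m, Γ m j i * ∑ l, gi j l * T l m =
      ∑ k, ∑ l, gi k l * ∑ m, Γ m k i * T l m := by
    refine Finset.sum_congr rfl fun j _ => ?_
    simp only [Finset.mul_sum]
    rw [Finset.sum_comm]
    exact Finset.sum_congr rfl fun m _ => Finset.sum_congr rfl fun l _ => by ring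
  rw [divMixed, h, h3]
  simp only [cov, covT, mul_sub, Finset.sum_sub_distrib]

/-- The Ricci identity for covector fields. -/
lemma covT_cov_comm (hD : ∀ i j a, D i (D j a) = D j (D i a)) (hΓ : ∀ k i j, Γ k i j = Γ k j i)
    (w : ι → A) (k i l : ι) :
    covT D Γ (cov D Γ w) k i l - covT D Γ (cov D Γ w) i k l =
      -∑ m, curv D Γ k i m l * w m := by
  have key : ∀ k i, covT D Γ (cov D Γ w) k i l = D k (D i (w l)) - ∑ m, D k (Γ m i l) * w m
      - ∑ m, Γ m i l * D k (w m) - ∑ m, Γ m k l * D i (w m) + ∑ m, (∑ p, Γ m i p * Γ p k l) * w m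
      - ∑ p, Γ p k i * cov D Γ w p l := by
    intro k i
    have e : ∑ p, Γ p k l * ∑ m, Γ m i p * w m = ∑ m, (∑ p, Γ m i p * Γ p k l) * w m := by
      simp only [Finset.mul_sum, Finset.sum_mul]
      rw [Finset.sum_comm]
      exact Finset.sum_congr rfl fun m _ => Finset.sum_congr rfl fun l _ => by ring
    rw [← e, covT]
    simp only [cov, map_sub, map_sum, Derivation.leibniz, smul_eq_mul, mul_sub,
      Finset.sum_sub_distrib, Finset.sum_add_distrib]
    rw [Finset.sum_congr rfl fun m _ => mul_comm (w m) (D k (Γ m i l))]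
    ring
  rw [key k i, key i k, hD k i, Finset.sum_congr rfl fun p _ =>
    congrArg (· * cov D Γ w p l) (hΓ p k i)]
  simp only [curv_apply, sub_mul, add_mul, Finset.sum_sub_distrib, Finset.sum_add_distrib]
  ring

/-- `∇^k ∇_i w_k = ∂_i ∇^k w_k + R_i^k w_k`. -/
lemma divMixed_raise_cov_swap (hD : ∀ i j a, D i (D j a) = D j (D i a))
    (hΓ : ∀ k i j, Γ k i j = Γ k j i) (hc : InvCompat D Γ gi) (hs : gi.transpose = gi)
    (hgs : g.transpose = g) (hg : gi * g = 1) (w : ι → A) (i : ι) :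
    divMixed D Γ (fun j a => ∑ l, gi j l * cov D Γ w a l) i =
      D i (∑ k, ∑ l, gi k l * cov D Γ w k l) + ∑ k, ∑ l, ric D Γ i l * gi l k * w k := by
  have hs' : ∀ a b, gi a b = gi b a := fun a b => congrFun (congrFun hs b) a
  have ha : ∀ a b k l, (curv D Γ a b * gi) k l = -(curv D Γ a b * gi) l k := fun a b k l =>
    congrFun (congrFun (curv_mul_antisymm hD hc hs a b) l) k
  have e1 : ∀ k l, covT D Γ (fun l a => cov D Γ w a l) k l i = covT D Γ (cov D Γ w) k i l := by
    intro k l; simp only [covT]; ring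
  have e2 : ∑ k, ∑ l, gi k l * ∑ m, curv D Γ k i m l * w m =
      -∑ k, ∑ l, ric D Γ i l * gi l k * w k := by
    have e3 : ∀ m, ∑ l, ric D Γ i l * gi l m = (gi * Matrix.of (ric D Γ)) m i := by
      intro m
      simp only [Matrix.mul_apply, Matrix.of_apply]
      exact Finset.sum_congr rfl fun l _ => by
        rw [ric_symm hD hΓ hc hs hgs hg i l, hs' l m, mul_comm]
    simp only [← Finset.sum_mul, e3, mul_ric_apply hΓ hs]
    calc _ = ∑ m, ∑ k, ∑ l, gi k l * (curv D Γ k i m l * w m) := by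
          simp only [Finset.mul_sum]
          conv_rhs => rw [Finset.sum_comm]
          exact Finset.sum_congr rfl fun k _ => Finset.sum_comm
      _ = _ := by
          rw [← Finset.sum_neg_distrib]
          refine Finset.sum_congr rfl fun m _ => ?_
          rw [← neg_mul, ← Finset.sum_neg_distrib, Finset.sum_mul]
          refine Finset.sum_congr rfl fun k _ => ?_
          rw [← ha, Matrix.mul_apply, Finset.sum_mul]
          exact Finset.sum_congr rfl fun l _ => by rw [hs' k l]; ring
  rw [divMixed_raise hc, ← sum_mul_covT hc, ← sub_eq_iff_eq_add', ← Finset.sum_sub_distrib]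
  simp only [e1, ← Finset.sum_sub_distrib, ← mul_sub, covT_cov_comm hD hΓ, mul_neg,
    Finset.sum_neg_distrib, e2, neg_neg]

/-- The divergence of `f δ^j_i` is the gradient of `f`. -/
lemma divMixed_scalar (hΓ : ∀ k i j, Γ k i j = Γ k j i) (f : A) (i : ι) :
    divMixed D Γ (fun j a => if j = a then f else 0) i = D i f := by
  have h : ∀ j, D j (if j = i then f else 0) = if j = i then D i f else 0 := by
    intro j; split_ifs with h <;> simp [h]
  simp only [divMixed, h]
  simp [hΓ _ _ i]

lemma divMixed_add (T T' : ι → ι → A) (i : ι) :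
    divMixed D Γ (fun j a => T j a + T' j a) i = divMixed D Γ T i + divMixed D Γ T' i := by
  simp only [divMixed, map_add, mul_add, Finset.sum_add_distrib]; ring

lemma divMixed_half_mul (T : ι → ι → A) (i : ι) :
    divMixed D Γ (fun j a => half A * T j a) i = half A * divMixed D Γ T i := by
  simp only [divMixed, derivation_half_mul, mul_left_comm _ (half A), ← Finset.mul_sum]; ring

/-! #### The Levi-Civita connection -/

lemma chr_symm (hgs : g.transpose = g) (k i j : ι) : chr D g gi k i j = chr D g gi k j i := by
  have hs' : ∀ a b, g a b = g b a := fun a b => congrFun (congrFun hgs b) a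
  simp only [chr]
  congr 1
  refine Finset.sum_congr rfl fun l _ => ?_
  rw [hs' i j]; ring

lemma mul_conn_chr (hg : gi * g = 1) (i : ι) :
    g * conn (chr D g gi) i =
      Matrix.of fun l j => half A * (D i (g j l) + D j (g i l) - D l (g i j)) := by
  have h' : g * gi = 1 := mul_eq_one_comm.mp hg
  have : conn (chr D g gi) i =
      gi * Matrix.of fun l j => half A * (D i (g j l) + D j (g i l) - D l (g i j)) := by
    ext k j
    simp only [conn_apply, chr, Matrix.mul_apply, Matrix.of_apply, Finset.mul_sum]
    exact Finset.sum_congr rfl fun l _ => by ring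
  rw [this, ← mul_assoc, h', one_mul]

lemma invCompat_chr (hgs : g.transpose = g) (hg : gi * g = 1) :
    InvCompat D (chr D g gi) gi := by
  intro i
  have hs' : ∀ a b, g a b = g b a := fun a b => congrFun (congrFun hgs b) a
  have h' : g * gi = 1 := mul_eq_one_comm.mp hg
  have e : dM (D i) g = g * conn (chr D g gi) i + (g * conn (chr D g gi) i).transpose := by
    rw [mul_conn_chr hg]
    ext a b
    simp only [dM_apply, Matrix.add_apply, Matrix.of_apply, Matrix.transpose_apply]
    rw [hs' b a, hs' i a, hs' i b]
    linear_combination -(D i (g a b)) * two_mul_half (A := A)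
  rw [dM_inverse _ hg, e, Matrix.transpose_mul, hgs, mul_add, add_mul, ← mul_assoc, hg, one_mul,
    mul_assoc gi, mul_assoc _ g, h', mul_one]
  abel

lemma transpose_inverse (hgs : g.transpose = g) (hg : gi * g = 1) : gi.transpose = gi := by
  have h' : g * gi = 1 := mul_eq_one_comm.mp hg
  have h2 : gi.transpose * g = 1 := by rw [← hgs, ← Matrix.transpose_mul, h', Matrix.transpose_one]
  calc gi.transpose = gi.transpose * g * gi := by rw [mul_assoc, h', mul_one]
    _ = gi := by rw [h2, one_mul]

end Connection

/-! ### The ambient metric over a differential ring -/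

section Homothety

variable {A : Type*} [CommRing A] [Algebra ℝ A] {κ : Type} [Fintype κ] [DecidableEq κ]
  {D : κ → Derivation ℝ A A} {Γ : κ → κ → κ → A}

/-- A vector field whose covariant derivative is the identity is annihilated by the curvature. -/
lemma sum_curv_mul_homothety (hD : ∀ i j a, D i (D j a) = D j (D i a))
    (hΓ : ∀ k i j, Γ k i j = Γ k j i) (T : κ → A)
    (hT : ∀ i k, D i (T k) + ∑ l, Γ k i l * T l = if k = i then 1 else 0) (i j k : κ) :
    ∑ l, curv D Γ i j k l * T l = 0 := by
  have hT' : ∀ i k, D i (T k) = (if k = i then 1 else 0) - ∑ l, Γ k i l * T l := fun i k => by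
    rw [← hT i k]; ring
  have key : ∀ i j, ∑ l, D i (Γ k j l) * T l =
      -D i (D j (T k)) - Γ k j i + ∑ l, (∑ m, Γ k j m * Γ m i l) * T l := by
    intro i j
    have h1 : D i (D j (T k) + ∑ l, Γ k j l * T l) = 0 := by
      rw [hT]; split_ifs <;> simp
    have h2 : ∑ l, Γ k j l * ∑ m, Γ l i m * T m = ∑ l, (∑ m, Γ k j m * Γ m i l) * T l := by
      simp only [Finset.mul_sum, Finset.sum_mul]
      rw [Finset.sum_comm]
      exact Finset.sum_congr rfl fun l _ => Finset.sum_congr rfl fun m _ => by ring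
    rw [← h2]
    simp only [map_add, map_sum, Derivation.leibniz, smul_eq_mul, Finset.sum_add_distrib] at h1
    have h3 : ∑ l, Γ k j l * D i (T l) = Γ k j i - ∑ l, Γ k j l * ∑ m, Γ l i m * T m := by
      simp only [hT', mul_sub, Finset.sum_sub_distrib, mul_ite, mul_one, mul_zero,
        Finset.sum_ite_eq', Finset.mem_univ, if_true]
    have h4 : ∑ l, D i (Γ k j l) * T l = ∑ l, T l * D i (Γ k j l) :=
      Finset.sum_congr rfl fun l _ => mul_comm _ _
    rw [h3] at h1
    rw [h4]
    linear_combination h1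
  simp only [curv_apply, sub_mul, add_mul, Finset.sum_sub_distrib, Finset.sum_add_distrib, key]
  rw [hD i j, hΓ k i j]
  ring

end Homothety

/-- The algebraic content of an ambient metric `2ρ dt² + 2t dt dρ + t² g`: a ring `A` with
commuting derivations along `x` (indices `Sum.inl`), `t` (index `Sum.inr 0`) and `ρ` (index
`Sum.inr 1`), the coordinate functions `t` (with inverse `τ`) and `ρ`, and a symmetric matrix `g`
with inverse `gi`, both independent of `t`. -/
structure AmbientRing (A : Type*) [CommRing A] [Algebra ℝ A] (ι : Type) [Fintype ι]
    [DecidableEq ι] where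
  D : ι ⊕ Fin 2 → Derivation ℝ A A
  comm : ∀ I J a, D I (D J a) = D J (D I a)
  t : A
  τ : A
  ρ : A
  t_mul_τ : t * τ = 1
  D_t_x : ∀ i, D (Sum.inl i) t = 0
  D_t_t : D (Sum.inr 0) t = 1
  D_t_ρ : D (Sum.inr 1) t = 0
  D_ρ_x : ∀ i, D (Sum.inl i) ρ = 0
  D_ρ_t : D (Sum.inr 0) ρ = 0
  D_ρ_ρ : D (Sum.inr 1) ρ = 1
  g : Matrix ι ι A
  gi : Matrix ι ι A
  symm : g.transpose = g
  gi_mul_g : gi * g = 1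
  D_g_t : ∀ i j, D (Sum.inr 0) (g i j) = 0

namespace AmbientRing

variable {A : Type*} [CommRing A] [Algebra ℝ A] {ι : Type} [Fintype ι] [DecidableEq ι]
  (R : AmbientRing A ι)

attribute [simp] D_t_x D_t_t D_t_ρ D_ρ_x D_ρ_t D_ρ_ρ D_g_t

/-- The derivations along the base coordinates. -/
abbrev d (i : ι) : Derivation ℝ A A := R.D (Sum.inl i)

/-- The derivation `∂_∞`. -/
abbrev dInf : Derivation ℝ A A := R.D (Sum.inr 1)

/-- The derivation `∂_t`. -/
abbrev dt : Derivation ℝ A A := R.D (Sum.inr 0)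

/-- The ambient metric. -/
def h : Matrix (ι ⊕ Fin 2) (ι ⊕ Fin 2) A :=
  Matrix.fromBlocks (R.t ^ 2 • R.g) 0 0 !![2 * R.ρ, R.t; R.t, 0]

/-- The inverse of the ambient metric. -/
def hi : Matrix (ι ⊕ Fin 2) (ι ⊕ Fin 2) A :=
  Matrix.fromBlocks (R.τ ^ 2 • R.gi) 0 0 !![0, R.τ; R.τ, -2 * R.ρ * R.τ ^ 2]

/-- The Christoffel symbols of the metrics `g(ρ)`. -/
abbrev Γ : ι → ι → ι → A := chr R.d R.g R.gi

/-- The Christoffel symbols of the ambient metric. -/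
abbrev Γh : ι ⊕ Fin 2 → ι ⊕ Fin 2 → ι ⊕ Fin 2 → A := chr R.D R.h R.hi

/-- The Ricci tensor of the ambient metric. -/
abbrev Sh : ι ⊕ Fin 2 → ι ⊕ Fin 2 → A := ric R.D R.Γh

lemma g_swap (i j : ι) : R.g i j = R.g j i := congrFun (congrFun R.symm j) i

lemma h_symm : R.h.transpose = R.h := by
  rw [h, Matrix.fromBlocks_transpose, Matrix.transpose_smul, R.symm]
  congr 1
  ext i j; fin_cases i <;> fin_cases j <;> rfl

lemma τ_mul_t : R.τ * R.t = 1 := by rw [mul_comm, R.t_mul_τ]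

lemma hi_mul_h : R.hi * R.h = 1 := by
  rw [hi, h, Matrix.fromBlocks_multiply, ← Matrix.fromBlocks_one]
  congr 1
  · simp only [Matrix.smul_mul, Matrix.mul_smul, smul_smul, R.gi_mul_g, Matrix.mul_zero, add_zero]
    rw [← mul_pow, R.t_mul_τ, one_pow, one_smul]
  · simp
  · simp
  · rw [Matrix.zero_mul, zero_add]
    ext i j
    fin_cases i <;> fin_cases j <;> simp [Matrix.mul_apply, R.τ_mul_t]
    linear_combination (-2 * R.ρ * R.τ) * R.τ_mul_t

lemma D_τ (I : ι ⊕ Fin 2) : R.D I R.τ = -R.τ ^ 2 * R.D I R.t := by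
  have e : R.D I (R.t * R.τ) = 0 := by rw [R.t_mul_τ]; simp
  rw [Derivation.leibniz, smul_eq_mul, smul_eq_mul] at e
  linear_combination R.τ * e - (R.D I R.τ) * R.t_mul_τ

@[simp] lemma D_τ_x (i : ι) : R.D (Sum.inl i) R.τ = 0 := by simp [D_τ]
@[simp] lemma D_τ_t : R.D (Sum.inr 0) R.τ = -R.τ ^ 2 := by simp [D_τ]
@[simp] lemma D_τ_ρ : R.D (Sum.inr 1) R.τ = 0 := by simp [D_τ]

@[simp] lemma D_gi_t (i j : ι) : R.D (Sum.inr 0) (R.gi i j) = 0 := by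
  have e : dM (R.D (Sum.inr 0)) R.g = 0 := by ext; simp
  have := congrFun (congrFun (dM_inverse (R.D (Sum.inr 0)) R.gi_mul_g) i) j
  simpa [e] using this

@[simp] lemma D_Γ_t (k i j : ι) : R.D (Sum.inr 0) (R.Γ k i j) = 0 := by
  simp [chr, R.comm (Sum.inr 0)]

lemma sum_gi_mul_g (i j : ι) : ∑ l, R.gi i l * R.g l j = if i = j then 1 else 0 := by
  have := congrFun (congrFun R.gi_mul_g i) j
  rwa [Matrix.mul_apply, Matrix.one_apply] at this

lemma τ_sq_mul_t_sq : R.τ ^ 2 * R.t ^ 2 = 1 := by rw [← mul_pow, R.τ_mul_t, one_pow]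

@[simp] lemma D_two (I : ι ⊕ Fin 2) : R.D I 2 = 0 := by
  simpa using (R.D I).map_natCast 2

/-! #### The ambient Christoffel symbols -/

@[simp] lemma Γh_xxx (k i j : ι) : R.Γh (Sum.inl k) (Sum.inl i) (Sum.inl j) = R.Γ k i j := by
  simp [chr, h, hi, Fintype.sum_sum_type]
  refine congrArg _ (Finset.sum_congr rfl fun l _ => ?_)
  linear_combination (R.gi k l * (R.d i (R.g j l) + R.d j (R.g i l) - R.d l (R.g i j))) *
    R.τ_sq_mul_t_sq

@[simp] lemma Γh_xtx (k j : ι) : R.Γh (Sum.inl k) (Sum.inr 0) (Sum.inl j) =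
    if k = j then R.τ else 0 := by
  have e : ∑ l, R.τ ^ 2 * R.gi k l * (R.g j l * (2 * R.t)) =
      2 * R.τ * if k = j then 1 else 0 := by
    rw [← R.sum_gi_mul_g, Finset.mul_sum]
    refine Finset.sum_congr rfl fun l _ => ?_
    rw [R.g_swap l j]
    linear_combination (2 * R.τ * R.gi k l * R.g j l) * R.τ_mul_t
  simp [chr, h, hi, Fintype.sum_sum_type, e]
  split_ifs
  · linear_combination R.τ * two_mul_half (A := A)
  · rfl

@[simp] lemma Γh_xρx (k j : ι) : R.Γh (Sum.inl k) (Sum.inr 1) (Sum.inl j) =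
    half A * ∑ l, R.gi k l * R.dInf (R.g j l) := by
  simp [chr, h, hi, Fintype.sum_sum_type]
  refine congrArg _ (Finset.sum_congr rfl fun l _ => ?_)
  linear_combination (R.gi k l * R.dInf (R.g j l)) * R.τ_sq_mul_t_sq

@[simp] lemma Γh_xab (k : ι) (a b : Fin 2) : R.Γh (Sum.inl k) (Sum.inr a) (Sum.inr b) = 0 := by
  fin_cases a <;> fin_cases b <;> simp [chr, h, hi, Fintype.sum_sum_type]

@[simp] lemma Γh_txx (i j : ι) : R.Γh (Sum.inr 0) (Sum.inl i) (Sum.inl j) =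
    -(half A * R.t * R.dInf (R.g i j)) := by
  simp [chr, h, hi, Fintype.sum_sum_type, Fin.sum_univ_two]
  linear_combination (half A * R.t * R.dInf (R.g i j)) * R.τ_mul_t

@[simp] lemma Γh_txa (i : ι) (a : Fin 2) : R.Γh (Sum.inr 0) (Sum.inl i) (Sum.inr a) = 0 := by
  fin_cases a <;> simp [chr, h, hi, Fintype.sum_sum_type, Fin.sum_univ_two]

@[simp] lemma Γh_tab (a b : Fin 2) : R.Γh (Sum.inr 0) (Sum.inr a) (Sum.inr b) = 0 := by
  fin_cases a <;> fin_cases b <;>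
    simp [chr, h, hi, Fintype.sum_sum_type, Fin.sum_univ_two]
  ring

@[simp] lemma Γh_ρxx (i j : ι) : R.Γh (Sum.inr 1) (Sum.inl i) (Sum.inl j) =
    -R.g i j + R.ρ * R.dInf (R.g i j) := by
  simp [chr, h, hi, Fintype.sum_sum_type, Fin.sum_univ_two]
  linear_combination (-R.g i j * 2 * half A) * R.τ_mul_t - R.g i j * two_mul_half (A := A)
    + (half A * 2 * R.ρ * R.dInf (R.g i j)) * R.τ_sq_mul_t_sq
    + (R.ρ * R.dInf (R.g i j)) * two_mul_half (A := A)

@[simp] lemma Γh_ρxa (i : ι) (a : Fin 2) : R.Γh (Sum.inr 1) (Sum.inl i) (Sum.inr a) = 0 := by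
  fin_cases a <;> simp [chr, h, hi, Fintype.sum_sum_type, Fin.sum_univ_two]

@[simp] lemma Γh_ρtt : R.Γh (Sum.inr 1) (Sum.inr 0) (Sum.inr 0) = 0 := by
  simp [chr, h, hi, Fintype.sum_sum_type, Fin.sum_univ_two]
  ring

@[simp] lemma Γh_ρtρ : R.Γh (Sum.inr 1) (Sum.inr 0) (Sum.inr 1) = R.τ := by
  simp [chr, h, hi, Fintype.sum_sum_type, Fin.sum_univ_two]
  linear_combination R.τ * two_mul_half (A := A)

@[simp] lemma Γh_ρρρ : R.Γh (Sum.inr 1) (Sum.inr 1) (Sum.inr 1) = 0 := by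
  simp [chr, h, hi, Fintype.sum_sum_type, Fin.sum_univ_two]

lemma Γh_symm (K I J : ι ⊕ Fin 2) : R.Γh K I J = R.Γh K J I := chr_symm R.h_symm K I J

@[simp] lemma Γh_xxt (k j : ι) : R.Γh (Sum.inl k) (Sum.inl j) (Sum.inr 0) =
    if k = j then R.τ else 0 := by rw [Γh_symm, Γh_xtx]

@[simp] lemma Γh_xxρ (k j : ι) : R.Γh (Sum.inl k) (Sum.inl j) (Sum.inr 1) =
    half A * ∑ l, R.gi k l * R.dInf (R.g j l) := by rw [Γh_symm, Γh_xρx]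

@[simp] lemma Γh_tax (i : ι) (a : Fin 2) : R.Γh (Sum.inr 0) (Sum.inr a) (Sum.inl i) = 0 := by
  rw [Γh_symm, Γh_txa]

@[simp] lemma Γh_ρax (i : ι) (a : Fin 2) : R.Γh (Sum.inr 1) (Sum.inr a) (Sum.inl i) = 0 := by
  rw [Γh_symm, Γh_ρxa]

@[simp] lemma Γh_ρρt : R.Γh (Sum.inr 1) (Sum.inr 1) (Sum.inr 0) = R.τ := by
  rw [Γh_symm, Γh_ρtρ]

lemma hi_symm : R.hi.transpose = R.hi := transpose_inverse R.h_symm R.hi_mul_h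

lemma Γh_compat : InvCompat R.D R.Γh R.hi := invCompat_chr R.h_symm R.hi_mul_h

lemma Sh_symm (I J : ι ⊕ Fin 2) : R.Sh I J = R.Sh J I :=
  ric_symm R.comm R.Γh_symm R.Γh_compat R.hi_symm R.h_symm R.hi_mul_h I J

/-- The vector field `t ∂_t` is homothetic, hence it is in the kernel of the Ricci tensor. -/
@[simp] lemma Sh_t_left (J : ι ⊕ Fin 2) : R.Sh (Sum.inr 0) J = 0 := by
  have key : ∀ i k, R.D i (if k = Sum.inr 0 then R.t else 0) +
      ∑ l, R.Γh k i l * (if l = Sum.inr 0 then R.t else 0) = if k = i then 1 else 0 := by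
    intro i k
    simp only [mul_ite, mul_zero, Finset.sum_ite_eq', Finset.mem_univ, if_true]
    rcases i with i | i <;> rcases k with k | k
    · by_cases hik : k = i <;> simp [hik, R.τ_mul_t]
    · fin_cases k <;> simp
    · fin_cases i <;> simp
    · fin_cases i <;> fin_cases k <;> simp [R.τ_mul_t]
  have hz : ∀ k, R.t * curv R.D R.Γh k J k (Sum.inr 0) = 0 := by
    intro k
    have := sum_curv_mul_homothety R.comm R.Γh_symm _ key k J k
    simpa [mul_comm] using this
  rw [Sh, ric_eq_sum_curv R.Γh_symm]
  refine Finset.sum_eq_zero fun k _ => ?_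
  linear_combination R.τ * hz k - curv R.D R.Γh k J k (Sum.inr 0) * R.τ_mul_t

@[simp] lemma Sh_t_right (J : ι ⊕ Fin 2) : R.Sh J (Sum.inr 0) = 0 := by
  rw [Sh_symm, Sh_t_left]

/-- The degree of homogeneity in `t` that an upper index contributes to a tensor component: `1` for
the index `t` and `0` for the others, as an element of the ring. -/
def wt : ι ⊕ Fin 2 → A := Sum.elim 0 ![1, 0]

@[simp] lemma D_wt (I J : ι ⊕ Fin 2) : R.D J (wt I : A) = 0 := by
  rcases I with i | i
  · simp [wt]
  · fin_cases i <;> simp [wt]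

/-- `Γ^K_{IJ}` is homogeneous in `t`, of the degree given by its indices. -/
lemma dt_Γh (K I J : ι ⊕ Fin 2) :
    R.dt (R.Γh K I J) = (wt K - wt I - wt J) * R.τ * R.Γh K I J := by
  have hg : ∀ i j, R.D (Sum.inr 0) (R.dInf (R.g i j)) = 0 := fun i j => by
    rw [R.comm]; simp
  rcases K with k | k <;> rcases I with i | i <;> rcases J with j | j
  · simp [wt]
  · fin_cases j
    · by_cases hk : k = i <;> simp [wt, hk]; ring
    · simp [wt, hg]
  · fin_cases i
    · by_cases hk : k = j <;> simp [wt, hk]; ring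
    · simp [wt, hg]
  · simp
  · fin_cases k
    · simp [wt, hg]; linear_combination (-R.dInf (R.g i j) * half A) * R.τ_mul_t
    · simp [wt, hg]
  · fin_cases k <;> simp
  · fin_cases k <;> simp
  · fin_cases k <;> fin_cases i <;> fin_cases j <;> simp [wt] <;> ring

lemma D_t (M : ι ⊕ Fin 2) : R.D M R.t = wt M := by
  rcases M with i | i
  · simp [wt]
  · fin_cases i <;> simp [wt]

lemma wt_mul_dt (M : ι ⊕ Fin 2) (a : A) : wt M * R.D M a = wt M * R.dt a := by
  rcases M with i | i
  · simp [wt]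
  · fin_cases i <;> simp [wt]

/-- Homogeneity of the derivative of a homogeneous element of degree `c`. -/
lemma dt_D (M : ι ⊕ Fin 2) {a c : A} (hc : R.D M c = 0) (h : R.dt a = c * R.τ * a) :
    R.dt (R.D M a) = (c - wt M) * R.τ * R.D M a := by
  rw [R.comm, h]
  have e := R.wt_mul_dt M a
  rw [h] at e
  simp only [Derivation.leibniz, smul_eq_mul, hc, R.D_τ, R.D_t]
  linear_combination R.τ * e

/-- The ambient Ricci tensor is homogeneous in `t`; its components without an index `t` do not
depend on `t`. -/
lemma dt_Sh (I J : ι ⊕ Fin 2) : R.dt (R.Sh I J) = (-wt I - wt J) * R.τ * R.Sh I J := by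
  simp only [ric, map_add, map_sum, map_sub, mul_add, Finset.mul_sum, mul_sub]
  congr 1
  · refine Finset.sum_congr rfl fun k _ => ?_
    rw [R.dt_D k (by simp) (R.dt_Γh k I J), R.dt_D J (by simp) (R.dt_Γh k I k)]
    ring
  · refine Finset.sum_congr rfl fun k _ => Finset.sum_congr rfl fun l _ => ?_
    simp only [Derivation.leibniz, smul_eq_mul, R.dt_Γh]
    ring

@[simp] lemma dt_Sh_ρ_ρ : R.D (Sum.inr 0) (R.Sh (Sum.inr 1) (Sum.inr 1)) = 0 := by
  rw [R.dt_Sh]; simp [wt]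

@[simp] lemma dt_Sh_ρ_x (i : ι) : R.D (Sum.inr 0) (R.Sh (Sum.inr 1) (Sum.inl i)) = 0 := by
  rw [R.dt_Sh]; simp [wt]

lemma hi_mul_Sh_x (j : ι) (J : ι ⊕ Fin 2) : (R.hi * Matrix.of R.Sh) (Sum.inl j) J =
    R.τ ^ 2 * ∑ l, R.gi j l * R.Sh (Sum.inl l) J := by
  simp [hi, Matrix.mul_apply, Fintype.sum_sum_type, Finset.mul_sum, mul_assoc]

lemma hi_mul_Sh_t (J : ι ⊕ Fin 2) : (R.hi * Matrix.of R.Sh) (Sum.inr 0) J =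
    R.τ * R.Sh (Sum.inr 1) J := by
  simp [hi, Matrix.mul_apply, Fintype.sum_sum_type, Fin.sum_univ_two]

lemma hi_mul_Sh_ρ (J : ι ⊕ Fin 2) : (R.hi * Matrix.of R.Sh) (Sum.inr 1) J =
    -2 * R.ρ * R.τ ^ 2 * R.Sh (Sum.inr 1) J := by
  simp [hi, Matrix.mul_apply, Fintype.sum_sum_type, Fin.sum_univ_two]

/-- The trace `g^{ij} g'_{ij}`. -/
def trP : A := ∑ i, ∑ j, R.gi i j * R.dInf (R.g i j)

/-- The tensor `g^{jl} S_{lk}` of mixed type. -/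
def X (j k : ι) : A := ∑ l, R.gi j l * R.Sh (Sum.inl l) (Sum.inl k)

lemma trace_hi_mul_Sh : ∑ J, (R.hi * Matrix.of R.Sh) J J =
    R.τ ^ 2 * (∑ j, R.X j j - 2 * R.ρ * R.Sh (Sum.inr 1) (Sum.inr 1)) := by
  simp only [Fintype.sum_sum_type, Fin.sum_univ_two, hi_mul_Sh_x, hi_mul_Sh_t, hi_mul_Sh_ρ,
    ← Finset.mul_sum, Sh_t_right]
  simp only [X]
  ring

lemma hi_mul_Sh_xx (j k : ι) :
    (R.hi * Matrix.of R.Sh) (Sum.inl j) (Sum.inl k) = R.τ ^ 2 * R.X j k := R.hi_mul_Sh_x j _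

lemma gi_swap (i j : ι) : R.gi i j = R.gi j i :=
  congrFun (congrFun (transpose_inverse R.symm R.gi_mul_g) j) i

/-- Raising an index and lowering it again. -/
lemma sum_g_mul_gi (w : ι → A) (k : ι) : ∑ x, R.g x k * ∑ l, R.gi x l * w l = w k := by
  have e : ∑ x, R.g x k * ∑ l, R.gi x l * w l = ∑ l, (∑ x, R.gi l x * R.g x k) * w l := by
    simp only [Finset.mul_sum, Finset.sum_mul]
    rw [Finset.sum_comm]
    exact Finset.sum_congr rfl fun l _ => Finset.sum_congr rfl fun x _ => by
      rw [R.gi_swap l x]; ring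
  rw [e]
  simp [R.sum_gi_mul_g]

lemma sum_eq_trP : ∑ i, ∑ j, R.gi i j * R.dInf (R.g i j) = R.trP := rfl

/-- The contracted ambient Bianchi identity along the base. With the first index raised, the
ambient Ricci tensor has the components `t^{-2} g^{jl} S_{lk}`, `t^{-1} S_{∞k}` and
`-2 ρ t^{-2} S_{∞k}`; every term of the identity carries a factor `t^{-2}`. -/
theorem bianchi_x (k : ι) :
    divMixed R.d R.Γ R.X k - 2 * R.ρ * R.dInf (R.Sh (Sum.inr 1) (Sum.inl k))
      + (Fintype.card ι - 2 - R.ρ * R.trP) * R.Sh (Sum.inr 1) (Sum.inl k) =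
    half A * R.d k (∑ j, R.X j j - 2 * R.ρ * R.Sh (Sum.inr 1) (Sum.inr 1)) := by
  have hb := divMixed_ric R.comm R.Γh_symm R.Γh_compat R.hi_symm (Sum.inl k)
  rw [R.trace_hi_mul_Sh] at hb
  simp only [divMixed] at hb
  have p0 : ∀ u, half A * R.D (Sum.inl k) (R.τ ^ 2 * u) = R.τ ^ 2 * (half A * R.d k u) := by
    intro u; simp; ring
  have p1 : ∑ J, R.D J ((R.hi * Matrix.of R.Sh) J (Sum.inl k)) =
      R.τ ^ 2 * (∑ j, R.d j (R.X j k) - 3 * R.Sh (Sum.inr 1) (Sum.inl k)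
        - 2 * R.ρ * R.dInf (R.Sh (Sum.inr 1) (Sum.inl k))) := by
    have e : ∀ j, R.D (Sum.inl j) (R.τ ^ 2 * R.X j k) = R.τ ^ 2 * R.d j (R.X j k) := by simp
    simp only [Fintype.sum_sum_type, Fin.sum_univ_two, hi_mul_Sh_xx, hi_mul_Sh_t,
      hi_mul_Sh_ρ, e, ← Finset.mul_sum]
    simp
    ring
  have p2 : ∑ J, ∑ M, R.Γh J J M * (R.hi * Matrix.of R.Sh) M (Sum.inl k) =
      R.τ ^ 2 * (∑ j, ∑ m, R.Γ j j m * R.X m k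
        + (Fintype.card ι + 1 - R.ρ * R.trP) * R.Sh (Sum.inr 1) (Sum.inl k)) := by
    simp only [Fintype.sum_sum_type, Fin.sum_univ_two, hi_mul_Sh_xx, hi_mul_Sh_t,
      hi_mul_Sh_ρ, Γh_xxx, Γh_xxt, Γh_xxρ, Γh_tax, Γh_ρax, Γh_tab, Γh_ρρt, Γh_ρρρ, if_true,
      Finset.sum_add_distrib, zero_mul, Finset.sum_const_zero, mul_left_comm _ (R.τ ^ 2),
      ← Finset.mul_sum, ← Finset.sum_mul, sum_eq_trP, Finset.sum_const, Finset.card_univ,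
      nsmul_eq_mul]
    linear_combination (-R.τ ^ 2 * R.ρ * R.trP * R.Sh (Sum.inr 1) (Sum.inl k)) *
      two_mul_half (A := A)
  have p3 : ∑ J, ∑ M, R.Γh M J (Sum.inl k) * (R.hi * Matrix.of R.Sh) J M =
      R.τ ^ 2 * (∑ j, ∑ m, R.Γ m j k * R.X j m) := by
    have e1 : ∑ x, (-R.g x k + R.ρ * R.dInf (R.g x k)) *
        (R.τ ^ 2 * ∑ l, R.gi x l * R.Sh (Sum.inl l) (Sum.inr 1)) =
        R.τ ^ 2 * (-R.Sh (Sum.inl k) (Sum.inr 1) + R.ρ * ∑ x, R.dInf (R.g x k) *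
          ∑ l, R.gi x l * R.Sh (Sum.inl l) (Sum.inr 1)) := by
      rw [← R.sum_g_mul_gi (fun l => R.Sh (Sum.inl l) (Sum.inr 1)) k]
      simp only [Finset.mul_sum, ← Finset.sum_neg_distrib, ← Finset.sum_add_distrib]
      exact Finset.sum_congr rfl fun x _ => Finset.sum_congr rfl fun l _ => by ring
    have e2 : ∑ x, (half A * ∑ l, R.gi x l * R.dInf (R.g k l)) *
        (-2 * R.ρ * R.τ ^ 2 * R.Sh (Sum.inr 1) (Sum.inl x)) =
        -(R.τ ^ 2 * (R.ρ * ∑ x, R.dInf (R.g x k) *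
          ∑ l, R.gi x l * R.Sh (Sum.inl l) (Sum.inr 1))) := by
      simp only [Finset.mul_sum, Finset.sum_mul, ← Finset.sum_neg_distrib]
      rw [Finset.sum_comm]
      refine Finset.sum_congr rfl fun x _ => Finset.sum_congr rfl fun l _ => ?_
      rw [R.g_swap x k, R.gi_swap x l, R.Sh_symm (Sum.inr 1)]
      linear_combination (-R.ρ * R.τ ^ 2 * R.gi l x * R.dInf (R.g k x) *
        R.Sh (Sum.inl l) (Sum.inr 1)) * two_mul_half (A := A)
    simp only [Fintype.sum_sum_type, Fin.sum_univ_two, hi_mul_Sh_xx,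
      R.hi_mul_Sh_x _ (Sum.inr _), hi_mul_Sh_t,
      hi_mul_Sh_ρ, Γh_xxx, Γh_xtx, Γh_xρx, Γh_tax, Γh_ρax, Γh_ρxx, Sh_t_right, mul_zero,
      zero_mul, Finset.sum_add_distrib, Finset.sum_const_zero, e1, e2, ite_mul,
      Finset.sum_ite_eq', Finset.mem_univ, if_true]
    simp only [mul_left_comm _ (R.τ ^ 2), ← Finset.mul_sum]
    rw [R.Sh_symm (Sum.inr 1)]
    ring
  rw [p0, p1, p2, p3] at hb
  rw [divMixed]
  -- multiply by `t²` and cancel `τ² t² = 1`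
  linear_combination R.t ^ 2 * hb - (∑ j, R.d j (R.X j k) - 3 * R.Sh (Sum.inr 1) (Sum.inl k)
        - 2 * R.ρ * R.dInf (R.Sh (Sum.inr 1) (Sum.inl k)) + ∑ j, ∑ m, R.Γ j j m * R.X m k
        + (Fintype.card ι + 1 - R.ρ * R.trP) * R.Sh (Sum.inr 1) (Sum.inl k)
        - ∑ j, ∑ m, R.Γ m j k * R.X j m - half A * R.d k
          (∑ j, R.X j j - 2 * R.ρ * R.Sh (Sum.inr 1) (Sum.inr 1))) * R.τ_sq_mul_t_sq

/-- The contracted ambient Bianchi identity along `ρ`. -/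
theorem bianchi_ρ :
    ∑ j, ∑ l, R.gi j l * cov R.d R.Γ (fun i => R.Sh (Sum.inr 1) (Sum.inl i)) j l
      - R.ρ * R.dInf (R.Sh (Sum.inr 1) (Sum.inr 1))
      + (Fintype.card ι - 2 - R.ρ * R.trP) * R.Sh (Sum.inr 1) (Sum.inr 1)
      - half A * ∑ j, ∑ m, (∑ l, R.gi m l * R.dInf (R.g j l)) * R.X j m =
    half A * R.dInf (∑ j, R.X j j) := by
  have hb := divMixed_ric R.comm R.Γh_symm R.Γh_compat R.hi_symm (Sum.inr 1)
  rw [R.trace_hi_mul_Sh] at hb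
  simp only [divMixed] at hb
  have hZ := div_raise (invCompat_chr R.symm R.gi_mul_g)
    (fun i => R.Sh (Sum.inr 1) (Sum.inl i)) (D := R.d)
  rw [← hZ]
  have e0 : ∀ j, (R.hi * Matrix.of R.Sh) (Sum.inl j) (Sum.inr 1) =
      R.τ ^ 2 * ∑ l, R.gi j l * R.Sh (Sum.inr 1) (Sum.inl l) := by
    intro j; rw [hi_mul_Sh_x]; simp only [R.Sh_symm (Sum.inr 1)]
  have p0 : half A * R.D (Sum.inr 1) (R.τ ^ 2 *
      (∑ j, R.X j j - 2 * R.ρ * R.Sh (Sum.inr 1) (Sum.inr 1))) =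
      R.τ ^ 2 * (half A * R.dInf (∑ j, R.X j j) - R.Sh (Sum.inr 1) (Sum.inr 1)
        - R.ρ * R.dInf (R.Sh (Sum.inr 1) (Sum.inr 1))) := by
    simp
    linear_combination (-R.τ ^ 2 * (R.Sh (Sum.inr 1) (Sum.inr 1)
        + R.ρ * R.dInf (R.Sh (Sum.inr 1) (Sum.inr 1)))) * two_mul_half (A := A)
  have p1 : ∑ J, R.D J ((R.hi * Matrix.of R.Sh) J (Sum.inr 1)) =
      R.τ ^ 2 * (∑ j, R.d j (∑ l, R.gi j l * R.Sh (Sum.inr 1) (Sum.inl l))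
        - 3 * R.Sh (Sum.inr 1) (Sum.inr 1)
        - 2 * R.ρ * R.dInf (R.Sh (Sum.inr 1) (Sum.inr 1))) := by
    have e : ∀ j u, R.D (Sum.inl j) (R.τ ^ 2 * u) = R.τ ^ 2 * R.d j u := by simp
    simp only [Fintype.sum_sum_type, Fin.sum_univ_two, e0, hi_mul_Sh_t,
      hi_mul_Sh_ρ, e, ← Finset.mul_sum]
    simp
    ring
  have p2 : ∑ J, ∑ M, R.Γh J J M * (R.hi * Matrix.of R.Sh) M (Sum.inr 1) =
      R.τ ^ 2 * (∑ j, ∑ m, R.Γ j j m * (∑ l, R.gi m l * R.Sh (Sum.inr 1) (Sum.inl l))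
        + (Fintype.card ι + 1 - R.ρ * R.trP) * R.Sh (Sum.inr 1) (Sum.inr 1)) := by
    simp only [Fintype.sum_sum_type, Fin.sum_univ_two, e0, hi_mul_Sh_t,
      hi_mul_Sh_ρ, Γh_xxx, Γh_xxt, Γh_xxρ, Γh_tax, Γh_ρax, Γh_tab, Γh_ρρt, Γh_ρρρ, if_true,
      Finset.sum_add_distrib, zero_mul, Finset.sum_const_zero, mul_left_comm _ (R.τ ^ 2),
      ← Finset.mul_sum, ← Finset.sum_mul, sum_eq_trP, Finset.sum_const, Finset.card_univ,
      nsmul_eq_mul]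
    linear_combination (-R.τ ^ 2 * R.ρ * R.trP * R.Sh (Sum.inr 1) (Sum.inr 1)) *
      two_mul_half (A := A)
  have p3 : ∑ J, ∑ M, R.Γh M J (Sum.inr 1) * (R.hi * Matrix.of R.Sh) J M =
      R.τ ^ 2 * (half A * ∑ j, ∑ m, (∑ l, R.gi m l * R.dInf (R.g j l)) * R.X j m
        + R.Sh (Sum.inr 1) (Sum.inr 1)) := by
    simp only [Fintype.sum_sum_type, Fin.sum_univ_two, hi_mul_Sh_xx, hi_mul_Sh_t,
      hi_mul_Sh_ρ, Γh_xxρ, Γh_xab, Γh_txa, Γh_ρxa, Γh_tab, Γh_ρtρ, Γh_ρρρ,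
      zero_mul, Finset.sum_add_distrib, Finset.sum_const_zero, mul_assoc (half A),
      mul_left_comm _ (R.τ ^ 2), ← Finset.mul_sum]
    ring
  rw [p0, p1, p2, p3] at hb
  linear_combination R.t ^ 2 * hb - (∑ j, R.d j (∑ l, R.gi j l * R.Sh (Sum.inr 1) (Sum.inl l))
        - 3 * R.Sh (Sum.inr 1) (Sum.inr 1)
        - 2 * R.ρ * R.dInf (R.Sh (Sum.inr 1) (Sum.inr 1))
        + ∑ j, ∑ m, R.Γ j j m * (∑ l, R.gi m l * R.Sh (Sum.inr 1) (Sum.inl l))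
        + (Fintype.card ι + 1 - R.ρ * R.trP) * R.Sh (Sum.inr 1) (Sum.inr 1)
        - (half A * ∑ j, ∑ m, (∑ l, R.gi m l * R.dInf (R.g j l)) * R.X j m
        + R.Sh (Sum.inr 1) (Sum.inr 1)) - (half A * R.dInf (∑ j, R.X j j)
        - R.Sh (Sum.inr 1) (Sum.inr 1)
        - R.ρ * R.dInf (R.Sh (Sum.inr 1) (Sum.inr 1)))) * R.τ_sq_mul_t_sq

end AmbientRing

namespace AmbientRing

variable {A : Type*} [CommRing A] [Algebra ℝ A] {ι : Type} [Fintype ι] [DecidableEq ι]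
  (R : AmbientRing A ι)

/-! ### The gauge fields and the remainder -/

/-- The tensor `g'^{ij}`. -/
def gPUp (i j : ι) : A := ∑ α, ∑ β, R.gi i α * R.gi j β * R.dInf (R.g α β)

/-- The vector `Q^i = ∂_∞ (g^{jk} Γ^i_{jk})`. -/
def Qv (i : ι) : A := R.dInf (∑ j, ∑ k, R.gi j k * R.Γ i j k)

/-- The remainder `E_{ij} = S_{ij} - ½ (∇_i G_j + ∇_j G_i) - g_{ij} γ`. -/
def Er (G : ι → A) (γ : A) (i j : ι) : A :=
  R.Sh (Sum.inl i) (Sum.inl j) - half A * (cov R.d R.Γ G i j + cov R.d R.Γ G j i) - R.g i j * γ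

/-- The trace of the remainder. -/
def trE (G : ι → A) (γ : A) : A := ∑ j, ∑ l, R.gi j l * R.Er G γ j l

/-- The operator `B¹`. -/
def B1 (G : ι → A) (γ : A) (i : ι) : A :=
  -half A * (∑ k, ∑ l, R.gi k l * covT R.d R.Γ (cov R.d R.Γ G) k l i)
    - half A * (∑ k, ∑ l, ric R.d R.Γ i l * R.gi l k * G k)
    - ((Fintype.card ι * half A - 1) * R.dInf (G i) - R.ρ * R.dInf (R.dInf (G i)))
    + half A * R.trP * R.ρ * R.dInf (G i) + half A * R.ρ * R.trP * R.d i γ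

/-- The operator `B²`. -/
def B2 (G : ι → A) (γ : A) : A :=
  -half A * (∑ k, ∑ l, R.gi k l * cov R.d R.Γ (fun j => R.d j γ) k l)
    - ((Fintype.card ι * half A - 2) * R.dInf γ - R.ρ * R.dInf (R.dInf γ))
    + R.trP * R.ρ * R.dInf γ
    - half A * (∑ i, R.Qv i * G i + ∑ i, ∑ j, R.gPUp i j * R.d i (G j))
    + half A * (∑ i, ∑ j, R.gPUp i j * cov R.d R.Γ G i j) + half A * R.trP * γ

lemma Γ_symm (k i j : ι) : R.Γ k i j = R.Γ k j i := chr_symm R.symm k i j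

lemma Γ_compat : InvCompat R.d R.Γ R.gi := invCompat_chr R.symm R.gi_mul_g

lemma gi_symm : R.gi.transpose = R.gi := transpose_inverse R.symm R.gi_mul_g

lemma gPUp_swap (i j : ι) : R.gPUp i j = R.gPUp j i := by
  rw [gPUp, gPUp, Finset.sum_comm]
  refine Finset.sum_congr rfl fun α _ => Finset.sum_congr rfl fun β _ => ?_
  rw [R.g_swap β α]; ring

lemma sum_gPUp_mul_g : ∑ i, ∑ j, R.gPUp i j * R.g i j = R.trP := by
  have e : ∀ i, ∑ j, R.gPUp i j * R.g i j = ∑ α, R.gi i α * R.dInf (R.g α i) := by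
    intro i
    have e' : ∑ j, R.gPUp i j * R.g i j =
        ∑ α, ∑ β, R.gi i α * R.dInf (R.g α β) * ∑ j, R.gi β j * R.g j i := by
      simp only [gPUp, Finset.sum_mul, Finset.mul_sum]
      rw [Finset.sum_comm]
      refine Finset.sum_congr rfl fun α _ => ?_
      rw [Finset.sum_comm]
      refine Finset.sum_congr rfl fun β _ => Finset.sum_congr rfl fun j _ => ?_
      rw [R.g_swap i j, R.gi_swap j β]; ring
    rw [e']
    simp [R.sum_gi_mul_g]
  simp only [e, trP]
  exact Finset.sum_congr rfl fun i _ => Finset.sum_congr rfl fun j _ => by rw [R.g_swap i j]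

lemma dInf_gi (i j : ι) : R.dInf (R.gi i j) = -R.gPUp i j := by
  have := congrFun (congrFun (dM_inverse R.dInf R.gi_mul_g) i) j
  rw [dM_apply, Matrix.neg_apply] at this
  rw [this, gPUp]
  congr 1
  simp only [Matrix.mul_apply, Finset.sum_mul, dM_apply]
  rw [Finset.sum_comm]
  refine Finset.sum_congr rfl fun α _ => Finset.sum_congr rfl fun β _ => ?_
  rw [R.gi_swap β j]; ring

lemma sum_gi_mul_g' : ∑ j, ∑ l, R.gi j l * R.g j l = Fintype.card ι := by
  have e : ∀ j, ∑ l, R.gi j l * R.g j l = 1 := fun j => by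
    rw [← if_pos (rfl : j = j) (t := (1 : A)) (e := 0), ← R.sum_gi_mul_g j j]
    exact Finset.sum_congr rfl fun l _ => by rw [R.g_swap]
  simp [e]

variable (G : ι → A) (γ : A)

lemma Sh_eq_Er (i j : ι) : R.Sh (Sum.inl i) (Sum.inl j) =
    R.Er G γ i j + half A * (cov R.d R.Γ G i j + cov R.d R.Γ G j i) + R.g i j * γ := by
  rw [Er]; ring

/-- The mixed tensor `g^{-1} S` in terms of the remainder and the gauge fields. -/
lemma X_eq (j k : ι) : R.X j k = ∑ l, R.gi j l * R.Er G γ l k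
    + half A * (∑ l, R.gi j l * cov R.d R.Γ G l k + ∑ l, R.gi j l * cov R.d R.Γ G k l)
    + if j = k then γ else 0 := by
  have e : (if j = k then γ else 0) = ∑ l, R.gi j l * (R.g l k * γ) := by
    rw [← one_mul γ, ← zero_mul γ, ← ite_mul, ← R.sum_gi_mul_g, Finset.sum_mul]
    exact Finset.sum_congr rfl fun l _ => by ring
  rw [e, X, ← Finset.sum_add_distrib, Finset.mul_sum, ← Finset.sum_add_distrib,
    ← Finset.sum_add_distrib]
  exact Finset.sum_congr rfl fun l _ => by rw [R.Sh_eq_Er G γ]; ring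

lemma trace_X : ∑ j, R.X j j =
    R.trE G γ + ∑ k, ∑ l, R.gi k l * cov R.d R.Γ G k l + Fintype.card ι * γ := by
  have e : ∀ j, R.X j j = ∑ l, R.gi j l * R.Er G γ j l
      + half A * (∑ l, R.gi j l * cov R.d R.Γ G j l + ∑ l, R.gi j l * cov R.d R.Γ G l j)
      + ∑ l, (R.gi j l * R.g j l) * γ := by
    intro j
    rw [X, ← Finset.sum_add_distrib, Finset.mul_sum, ← Finset.sum_add_distrib,
      ← Finset.sum_add_distrib]
    exact Finset.sum_congr rfl fun l _ => by rw [R.Sh_symm, R.Sh_eq_Er G γ]; ring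
  have e2 : ∑ k, ∑ l, R.gi k l * cov R.d R.Γ G l k = ∑ k, ∑ l, R.gi k l * cov R.d R.Γ G k l := by
    rw [Finset.sum_comm]
    exact Finset.sum_congr rfl fun k _ => Finset.sum_congr rfl fun l _ => by rw [R.gi_swap l k]
  simp only [e, Finset.sum_add_distrib, ← Finset.mul_sum, ← Finset.sum_mul, e2, sum_gi_mul_g', trE]
  linear_combination (∑ k, ∑ l, R.gi k l * cov R.d R.Γ G k l) * two_mul_half (A := A)

variable {G γ}

/-- The operator `B¹` applied to the gauge fields is the divergence of the trace-reversed
remainder. The multiples of `∂_i γ` coming from `g γ`, from its trace and from `S_{∞i}` add up to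
the last term of `B¹`. -/
theorem B1_eq (hγ : R.dInf γ = R.Sh (Sum.inr 1) (Sum.inr 1))
    (hG : ∀ i, R.dInf (G i) = 2 * R.Sh (Sum.inl i) (Sum.inr 1) - R.d i γ) (i : ι) :
    R.B1 G γ i = divMixed R.d R.Γ (fun j k => ∑ l, R.gi j l * R.Er G γ l k) i
      - half A * R.d i (R.trE G γ) := by
  have hs : R.Sh (Sum.inr 1) (Sum.inl i) = half A * (R.dInf (G i) + R.d i γ) := by
    rw [R.Sh_symm, hG]
    linear_combination (-R.Sh (Sum.inl i) (Sum.inr 1)) * two_mul_half (A := A)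
  have hb := R.bianchi_x i
  have hX : R.X = fun j k => (∑ l, R.gi j l * R.Er G γ l k
    + half A * (∑ l, R.gi j l * cov R.d R.Γ G l k + ∑ l, R.gi j l * cov R.d R.Γ G k l))
    + if j = k then γ else 0 := by
    funext j k; exact R.X_eq G γ j k
  have hdiv : divMixed R.d R.Γ R.X i =
      divMixed R.d R.Γ (fun j k => ∑ l, R.gi j l * R.Er G γ l k) i
      + half A * (∑ k, ∑ l, R.gi k l * covT R.d R.Γ (cov R.d R.Γ G) k l i
        + (R.d i (∑ k, ∑ l, R.gi k l * cov R.d R.Γ G k l)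
          + ∑ k, ∑ l, ric R.d R.Γ i l * R.gi l k * G k)) + R.d i γ := by
    rw [hX, divMixed_add, divMixed_add, divMixed_half_mul, divMixed_add,
      divMixed_scalar R.Γ_symm, divMixed_raise R.Γ_compat (cov R.d R.Γ G),
      divMixed_raise_cov_swap (fun i j => R.comm _ _) R.Γ_symm R.Γ_compat R.gi_symm R.symm
        R.gi_mul_g]
  have hdd : R.dInf (R.d i γ) = R.d i (R.Sh (Sum.inr 1) (Sum.inr 1)) := by
    rw [R.comm, hγ]
  rw [hdiv, R.trace_X G γ, hs] at hb
  simp only [map_add, map_sub, Derivation.leibniz, smul_eq_mul, derivation_half, D_two, D_ρ_x,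
    Derivation.map_natCast, mul_zero, add_zero, hdd] at hb
  rw [B1]
  linear_combination -hb - (R.ρ * R.dInf (R.dInf (G i)) + R.dInf (G i) + R.d i γ) *
    two_mul_half (A := A)

/-- The commutator of `∂_∞` with the divergence of covector fields. -/
lemma dInf_div : R.dInf (∑ k, ∑ l, R.gi k l * cov R.d R.Γ G k l) =
    ∑ k, ∑ l, R.gi k l * cov R.d R.Γ (fun j => R.dInf (G j)) k l
      - (∑ i, R.Qv i * G i + ∑ i, ∑ j, R.gPUp i j * R.d i (G j)) := by
  have e : ∀ w : ι → A, ∑ k, ∑ l, R.gi k l * cov R.d R.Γ w k l =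
      ∑ k, ∑ l, R.gi k l * R.d k (w l) - ∑ i, (∑ j, ∑ k, R.gi j k * R.Γ i j k) * w i := by
    intro w
    simp only [cov, mul_sub, Finset.sum_sub_distrib, Finset.mul_sum, Finset.sum_mul]
    congr 1
    conv_rhs => rw [Finset.sum_comm]
    refine Finset.sum_congr rfl fun k _ => ?_
    rw [Finset.sum_comm]
    exact Finset.sum_congr rfl fun l _ => Finset.sum_congr rfl fun m _ => by ring
  have e1 : R.dInf (∑ k, ∑ l, R.gi k l * R.d k (G l)) =
      ∑ k, ∑ l, R.gi k l * R.d k (R.dInf (G l)) - ∑ i, ∑ j, R.gPUp i j * R.d i (G j) := by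
    simp only [map_sum, Derivation.leibniz, smul_eq_mul, ← Finset.sum_sub_distrib]
    refine Finset.sum_congr rfl fun k _ => Finset.sum_congr rfl fun l _ => ?_
    rw [R.dInf_gi, R.comm]; ring
  have e2 : R.dInf (∑ i, (∑ j, ∑ k, R.gi j k * R.Γ i j k) * G i) =
      ∑ i, (∑ j, ∑ k, R.gi j k * R.Γ i j k) * R.dInf (G i) + ∑ i, R.Qv i * G i := by
    rw [map_sum, ← Finset.sum_add_distrib]
    refine Finset.sum_congr rfl fun i _ => ?_
    rw [Derivation.leibniz, smul_eq_mul, smul_eq_mul, Qv, mul_comm (G i)]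
  rw [e, e, map_sub, e1, e2]
  ring

lemma sum_gPUp_mul_X : ∑ j, ∑ m, (∑ l, R.gi m l * R.dInf (R.g j l)) * R.X j m =
    ∑ i, ∑ j, R.gPUp i j * R.Sh (Sum.inl i) (Sum.inl j) := by
  have e : ∀ m, ∑ j, (∑ l, R.gi m l * R.dInf (R.g j l)) * R.X j m =
      ∑ p, R.gPUp p m * R.Sh (Sum.inl p) (Sum.inl m) := by
    intro m
    simp only [X, gPUp, Finset.sum_mul, Finset.mul_sum]
    rw [Finset.sum_comm]
    refine Finset.sum_congr rfl fun p _ => Finset.sum_congr rfl fun j _ =>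
      Finset.sum_congr rfl fun l _ => ?_
    rw [R.gi_swap p j]; ring
  rw [Finset.sum_comm]
  simp only [e]
  rw [Finset.sum_comm]

lemma sum_gPUp_mul_Sh : ∑ i, ∑ j, R.gPUp i j * R.Sh (Sum.inl i) (Sum.inl j) =
    ∑ i, ∑ j, R.gPUp i j * R.Er G γ i j + ∑ i, ∑ j, R.gPUp i j * cov R.d R.Γ G i j
      + R.trP * γ := by
  have e : ∑ i, ∑ j, R.gPUp i j * cov R.d R.Γ G j i = ∑ i, ∑ j, R.gPUp i j * cov R.d R.Γ G i j := by
    rw [Finset.sum_comm]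
    exact Finset.sum_congr rfl fun i _ => Finset.sum_congr rfl fun j _ => by rw [R.gPUp_swap]
  have e1 : ∀ i j, R.gPUp i j * R.Sh (Sum.inl i) (Sum.inl j) = R.gPUp i j * R.Er G γ i j
      + half A * (R.gPUp i j * cov R.d R.Γ G i j + R.gPUp i j * cov R.d R.Γ G j i)
      + R.gPUp i j * R.g i j * γ := fun i j => by rw [R.Sh_eq_Er G γ]; ring
  simp only [e1, Finset.sum_add_distrib, ← Finset.mul_sum, ← Finset.sum_mul, e, sum_gPUp_mul_g]
  linear_combination (∑ i, ∑ j, R.gPUp i j * cov R.d R.Γ G i j) * two_mul_half (A := A)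

/-- The operator `B²` applied to the gauge fields is a first order expression in the
remainder. -/
theorem B2_eq (hγ : R.dInf γ = R.Sh (Sum.inr 1) (Sum.inr 1))
    (hG : ∀ i, R.dInf (G i) = 2 * R.Sh (Sum.inl i) (Sum.inr 1) - R.d i γ) :
    R.B2 G γ = -half A * R.dInf (R.trE G γ)
      - half A * ∑ i, ∑ j, R.gPUp i j * R.Er G γ i j := by
  have hs : (fun i => R.Sh (Sum.inr 1) (Sum.inl i)) =
      fun i => half A * (R.dInf (G i) + R.d i γ) := by
    funext i
    rw [R.Sh_symm, hG]
    linear_combination (-R.Sh (Sum.inl i) (Sum.inr 1)) * two_mul_half (A := A)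
  have hb := R.bianchi_ρ
  have hdiv : ∑ k, ∑ l, R.gi k l * cov R.d R.Γ (fun i => half A * (R.dInf (G i) + R.d i γ)) k l =
      half A * (∑ k, ∑ l, R.gi k l * cov R.d R.Γ (fun j => R.dInf (G j)) k l
        + ∑ k, ∑ l, R.gi k l * cov R.d R.Γ (fun j => R.d j γ) k l) := by
    rw [← Finset.sum_add_distrib, Finset.mul_sum]
    refine Finset.sum_congr rfl fun k _ => ?_
    rw [← Finset.sum_add_distrib, Finset.mul_sum]
    refine Finset.sum_congr rfl fun l _ => ?_
    simp only [cov, derivation_half_mul, map_add, mul_left_comm _ (half A), ← Finset.mul_sum,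
      mul_add, Finset.sum_add_distrib]
    ring
  rw [hs, hdiv, R.sum_gPUp_mul_X, R.sum_gPUp_mul_Sh (G := G) (γ := γ), R.trace_X G γ, ← hγ,
    map_add, map_add, R.dInf_div] at hb
  simp only [Derivation.leibniz, smul_eq_mul, Derivation.map_natCast, mul_zero, add_zero] at hb
  rw [B2]
  linear_combination -hb - (Fintype.card ι * R.dInf γ) * two_mul_half (A := A)

end AmbientRing

/-! ### The ring of smooth functions on an open set -/

section SmoothRing

variable {κ : Type} [Fintype κ] [DecidableEq κ]

open TopologicalSpace (Opens)

/-- Extension of a function on an open set by zero; the values outside the set are irrelevant. -/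
def extZ (V : Opens (κ → ℝ)) (f : V → ℝ) : (κ → ℝ) → ℝ := Function.extend Subtype.val f 0

variable {V : Opens (κ → ℝ)}

lemma extZ_apply (f : V → ℝ) (v : V) : extZ V f v = f v := Subtype.val_injective.extend_apply f 0 v

lemma extZ_of_mem (f : V → ℝ) {y : κ → ℝ} (hy : y ∈ V) : extZ V f y = f ⟨y, hy⟩ :=
  extZ_apply f ⟨y, hy⟩

lemma extZ_restrict (F : (κ → ℝ) → ℝ) : Set.EqOn (extZ V fun v => F v) F V :=
  fun _ hy => extZ_of_mem _ hy

/-- The algebra of smooth functions on an open set. Its elements are functions on the subtype, so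
that equality in the algebra is equality on the open set. -/
def SmoothFun (V : Opens (κ → ℝ)) : Subalgebra ℝ (V → ℝ) where
  carrier := {f | ContDiffOn ℝ ∞ (extZ V f) V}
  mul_mem' {f g} hf hg := (ContDiffOn.mul hf hg).congr fun y hy => by
    simp only [extZ_of_mem _ hy, Pi.mul_apply]
  add_mem' {f g} hf hg := (ContDiffOn.add hf hg).congr fun y hy => by
    simp only [extZ_of_mem _ hy, Pi.add_apply]
  algebraMap_mem' r := (contDiffOn_const (c := r)).congr fun y hy => by
    rw [extZ_of_mem _ hy]; rfl

/-- The smooth function on `V` given by a function that is smooth on `V`. -/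
def SmoothFun.mk (F : (κ → ℝ) → ℝ) (hF : ContDiffOn ℝ ∞ F V) : SmoothFun V :=
  ⟨fun v => F v, hF.congr (extZ_restrict F)⟩

/-- Evaluation at a point. -/
def ev (v : V) : SmoothFun V →ₐ[ℝ] ℝ := (Pi.evalAlgHom ℝ (fun _ : V => ℝ) v).comp (SmoothFun V).val

lemma ev_mk (F : (κ → ℝ) → ℝ) (hF : ContDiffOn ℝ ∞ F V) (v : V) :
    ev v (SmoothFun.mk F hF) = F v := rfl

lemma SmoothFun.ext_ev {a b : SmoothFun V} (h : ∀ v, ev v a = ev v b) : a = b :=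
  Subtype.ext (funext h)

lemma extZ_eq_ev (a : SmoothFun V) (v : V) : extZ V a v = ev v a := extZ_apply _ v

lemma contDiffAt_extZ (a : SmoothFun V) (v : V) : ContDiffAt ℝ ∞ (extZ V a) v :=
  (a.2 : ContDiffOn ℝ ∞ (extZ V a) V).contDiffAt (V.isOpen.mem_nhds v.2)

lemma differentiableAt_extZ (a : SmoothFun V) (v : V) :
    DifferentiableAt ℝ (extZ V a) v := (contDiffAt_extZ a v).differentiableAt (by simp)

lemma contDiffOn_pd {F : (κ → ℝ) → ℝ} (hF : ContDiffOn ℝ ∞ F V) (i : κ) :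
    ContDiffOn ℝ ∞ (Ambient.pd i F) V := by
  have := hF.fderiv_of_isOpen V.isOpen (m := ∞) (by simp)
  exact this.clm_apply contDiffOn_const

lemma pd_congr {F G : (κ → ℝ) → ℝ} (h : Set.EqOn F G V) {y : κ → ℝ} (hy : y ∈ V) (i : κ) :
    Ambient.pd i F y = Ambient.pd i G y := by
  rw [Ambient.pd, Ambient.pd, (h.eventuallyEq_of_mem (V.isOpen.mem_nhds hy)).fderiv_eq]

/-- The coordinate derivation `∂_i` on smooth functions. -/
def partialD (V : Opens (κ → ℝ)) (i : κ) : Derivation ℝ (SmoothFun V) (SmoothFun V) :=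
  Derivation.mk'
    { toFun := fun a => SmoothFun.mk (Ambient.pd i (extZ V a)) (contDiffOn_pd a.2 i)
      map_add' := fun a b => SmoothFun.ext_ev fun v => by
        rw [map_add, ev_mk, ev_mk, ev_mk,
          pd_congr (G := fun y => extZ V a y + extZ V b y) (fun y hy => by
            simp only [extZ_of_mem _ hy]; rfl) v.2]
        simp only [Ambient.pd]
        rw [fderiv_fun_add (differentiableAt_extZ a v) (differentiableAt_extZ b v)]
        rfl
      map_smul' := fun r a => SmoothFun.ext_ev fun v => by
        rw [RingHom.id_apply, map_smul, ev_mk, ev_mk,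
          pd_congr (G := fun y => r • extZ V a y) (fun y hy => by
            simp only [extZ_of_mem _ hy]; rfl) v.2]
        simp only [Ambient.pd]
        rw [fderiv_fun_const_smul (differentiableAt_extZ a v)]
        rfl }
    fun a b => SmoothFun.ext_ev fun v => by
      simp only [LinearMap.coe_mk, AddHom.coe_mk, smul_eq_mul, map_add, map_mul, ev_mk]
      rw [pd_congr (G := fun y => extZ V a y * extZ V b y) (fun y hy => by
            simp only [extZ_of_mem _ hy]; rfl) v.2]
      simp only [Ambient.pd]
      rw [fderiv_fun_mul (differentiableAt_extZ a v) (differentiableAt_extZ b v)]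
      simp [extZ_eq_ev]

lemma ev_partialD (i : κ) (a : SmoothFun V) (v : V) :
    ev v (partialD V i a) = Ambient.pd i (extZ V a) v := rfl

/-- A function that agrees on `V` with a smooth function has the same partial derivatives. -/
lemma pd_eq_ev {F : (κ → ℝ) → ℝ} {a : SmoothFun V} (h : ∀ v : V, F v = ev v a) (v : V) (i : κ) :
    Ambient.pd i F v = ev v (partialD V i a) :=
  pd_congr (fun y hy => by rw [extZ_of_mem _ hy]; exact h ⟨y, hy⟩) v.2 i

lemma partialD_comm (i j : κ) (a : SmoothFun V) :
    partialD V i (partialD V j a) = partialD V j (partialD V i a) := by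
  have key : ∀ i j : κ, ∀ v : V, ev v (partialD V i (partialD V j a)) =
      fderiv ℝ (fderiv ℝ (extZ V a)) v (Pi.single i 1) (Pi.single j 1) := by
    intro i j v
    rw [← pd_eq_ev (F := Ambient.pd j (extZ V a)) (fun w => rfl)]
    have hd : DifferentiableAt ℝ (fderiv ℝ (extZ V a)) v :=
      ((contDiffAt_extZ a v).fderiv_right (m := ∞) (by simp)).differentiableAt (by simp)
    change fderiv ℝ (fun y => fderiv ℝ (extZ V a) y (Pi.single j 1)) v (Pi.single i 1) = _
    rw [fderiv_clm_apply hd (differentiableAt_const _)]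
    simp
  refine SmoothFun.ext_ev fun v => ?_
  rw [key, key]
  exact ((contDiffAt_extZ a v).isSymmSndFDerivAt
    (by rw [minSmoothness_of_isRCLikeNormedField]; exact ENat.LEInfty.out)).eq _ _

lemma isUnit_of_ev_ne_zero {a : SmoothFun V} (h : ∀ v, ev v a ≠ 0) : IsUnit a := by
  have hc : ContDiffOn ℝ ∞ (fun y => (extZ V a y)⁻¹) V :=
    ContDiffOn.inv a.2 fun y hy => by rw [extZ_of_mem _ hy]; exact h ⟨y, hy⟩
  refine IsUnit.of_mul_eq_one (SmoothFun.mk _ hc) (SmoothFun.ext_ev fun v => ?_)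
  rw [map_mul, ev_mk, extZ_eq_ev, mul_inv_cancel₀ (h v), map_one]

lemma ev_half (v : V) : ev v (half (SmoothFun V)) = 1 / 2 := (ev v).commutes _

end SmoothRing

/-! ### Smooth dependence of integrals on parameters -/

section Integral

/-- An integral over `[0, 1]` of a function that is smooth in all variables is smooth in the
parameters. The regularity increases by differentiation under the integral sign; the codomain is
arbitrary since the derivative takes values in a space of linear maps. -/
lemma contDiffOn_integral_unit {P : Type} [NormedAddCommGroup P] [NormedSpace ℝ P]
    [FiniteDimensional ℝ P] {O : Set (ℝ × P)} (hO : IsOpen O) {U : Set P} (hU : IsOpen U)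
    (hOU : ∀ s ∈ Set.Icc (0 : ℝ) 1, ∀ p ∈ U, (s, p) ∈ O) (n : ℕ) :
    ∀ {G : Type} [NormedAddCommGroup G] [NormedSpace ℝ G] [CompleteSpace G] (w : ℝ × P → G),
      ContDiffOn ℝ ∞ w O → ContDiffOn ℝ n (fun p => ∫ s in (0 : ℝ)..1, w (s, p)) U := by
  have hder : ∀ {G : Type} [NormedAddCommGroup G] [NormedSpace ℝ G] [CompleteSpace G]
      (w : ℝ × P → G), ContDiffOn ℝ ∞ w O → ∀ p ∈ U,
      HasFDerivAt (fun p => ∫ s in (0 : ℝ)..1, w (s, p))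
        (∫ s in (0 : ℝ)..1, (fderiv ℝ w (s, p)).comp (ContinuousLinearMap.inr ℝ ℝ P)) p := by
    intro G _ _ _ w hw p hp
    have : ProperSpace P := FiniteDimensional.proper ℝ P
    have hw' : ContDiffOn ℝ ∞ (fun q => (fderiv ℝ w q).comp (ContinuousLinearMap.inr ℝ ℝ P)) O :=
      (hw.fderiv_of_isOpen hO (m := ∞) (by simp)).clm_comp contDiffOn_const
    obtain ⟨r, hr, hrU⟩ := Metric.nhds_basis_closedBall.mem_iff.mp (hU.mem_nhds hp)
    have hK : IsCompact (Set.Icc (0 : ℝ) 1 ×ˢ Metric.closedBall p r) :=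
      isCompact_Icc.prod (isCompact_closedBall p r)
    have hKO : Set.Icc (0 : ℝ) 1 ×ˢ Metric.closedBall p r ⊆ O :=
      fun q hq => hOU q.1 hq.1 q.2 (hrU hq.2)
    obtain ⟨C, hC⟩ := hK.exists_bound_of_continuousOn (hw'.continuousOn.mono hKO)
    have hslice : ∀ {H : Type} [NormedAddCommGroup H] [NormedSpace ℝ H] (z : ℝ × P → H),
        ContinuousOn z O → ∀ q ∈ U, ContinuousOn (fun s => z (s, q)) (Set.uIcc (0 : ℝ) 1) := by
      intro H _ _ z hz q hq
      rw [Set.uIcc_of_le zero_le_one]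
      exact hz.comp (by fun_prop) fun s hs => hOU s hs q hq
    have hsub : Set.uIoc (0 : ℝ) 1 ⊆ Set.Icc 0 1 := by
      rw [Set.uIoc_of_le zero_le_one]; exact Set.Ioc_subset_Icc_self
    refine (intervalIntegral.hasFDerivAt_integral_of_dominated_of_fderiv_le (𝕜 := ℝ)
      (F := fun p s => w (s, p))
      (F' := fun p s => (fderiv ℝ w (s, p)).comp (ContinuousLinearMap.inr ℝ ℝ P)) (bound := fun _ => C) (s := Metric.ball p r) (Metric.ball_mem_nhds p hr) ?_ ?_ ?_ ?_ ?_ ?_)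
    · filter_upwards [hU.mem_nhds hp] with q hq
      exact ((hslice w hw.continuousOn q hq).mono Set.uIoc_subset_uIcc).aestronglyMeasurable
        measurableSet_uIoc
    · exact (hslice w hw.continuousOn p hp).intervalIntegrable
    · exact ((hslice _ hw'.continuousOn p hp).mono Set.uIoc_subset_uIcc).aestronglyMeasurable
        measurableSet_uIoc
    · exact Eventually.of_forall fun s hs q hq =>
        hC (s, q) ⟨hsub hs, Metric.ball_subset_closedBall hq⟩
    · exact intervalIntegrable_const
    · refine Eventually.of_forall fun s hs q hq => ?_
      have hm : (s, q) ∈ O := hOU s (hsub hs) q (hrU (Metric.ball_subset_closedBall hq))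
      have h1 : HasFDerivAt w (fderiv ℝ w (s, q)) (s, q) :=
        ((hw.contDiffAt (hO.mem_nhds hm)).differentiableAt (by simp)).hasFDerivAt
      exact h1.comp q (hasFDerivAt_prodMk_right s q)
  induction n with
  | zero =>
    intro G _ _ _ w hw
    rw [Nat.cast_zero, contDiffOn_zero]
    exact fun p hp => (hder w hw p hp).continuousAt.continuousWithinAt
  | succ n ih =>
    intro G _ _ _ w hw
    rw [Nat.cast_succ, contDiffOn_succ_iff_fderiv_of_isOpen hU]
    refine ⟨fun p hp => (hder w hw p hp).differentiableAt.differentiableWithinAt, by simp, ?_⟩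
    refine (ih (fun q => (fderiv ℝ w q).comp (ContinuousLinearMap.inr ℝ ℝ P)) ?_).congr
      fun p hp => (hder w hw p hp).fderiv
    exact (hw.fderiv_of_isOpen hO (m := ∞) (by simp)).clm_comp contDiffOn_const

variable {E : Type} [NormedAddCommGroup E] [NormedSpace ℝ E] [FiniteDimensional ℝ E]

/-- The primitive in `ρ` of a smooth function on a product domain is smooth: by rescaling, it is
`ρ` times an integral over `[0, 1]` with smooth parameters. -/
lemma contDiffOn_primitive {ε : ℝ} {B : Set E} (hB : IsOpen B) {u : ℝ × E → ℝ}
    (hu : ContDiffOn ℝ ∞ u (Set.Ioo (-ε) ε ×ˢ B)) :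
    ContDiffOn ℝ ∞ (fun p : ℝ × E => ∫ s in (0 : ℝ)..p.1, u (s, p.2)) (Set.Ioo (-ε) ε ×ˢ B) := by
  have hU : IsOpen (Set.Ioo (-ε) ε ×ˢ B) := isOpen_Ioo.prod hB
  have hmap : ContDiff ℝ ∞ fun q : ℝ × (ℝ × E) => (q.1 * q.2.1, q.2.2) := by fun_prop
  have hw := hu.comp (hmap.contDiffOn (s := (fun q : ℝ × (ℝ × E) => (q.1 * q.2.1, q.2.2)) ⁻¹'
    (Set.Ioo (-ε) ε ×ˢ B))) fun q hq => hq
  have hO := hU.preimage hmap.continuous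
  have hint : ContDiffOn ℝ ∞ (fun p : ℝ × E => ∫ s in (0 : ℝ)..1, u (s * p.1, p.2))
      (Set.Ioo (-ε) ε ×ˢ B) := by
    refine contDiffOn_infty.mpr fun n => contDiffOn_integral_unit hO hU ?_ n _ hw
    rintro s ⟨hs0, hs1⟩ p ⟨⟨hp1, hp2⟩, hp3⟩
    refine ⟨⟨?_, ?_⟩, hp3⟩
    · nlinarith
    · nlinarith
  refine (contDiffOn_fst.mul hint).congr fun p _ => ?_
  have := intervalIntegral.mul_integral_comp_mul_right (a := 0) (b := 1)
    (f := fun s => u (s, p.2)) p.1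
  simpa using this.symm

lemma hasDerivAt_primitive {ε : ℝ} {f : ℝ → ℝ} (hf : ContinuousOn f (Set.Ioo (-ε) ε)) {ρ : ℝ}
    (hρ : ρ ∈ Set.Ioo (-ε) ε) : HasDerivAt (fun r => ∫ s in (0 : ℝ)..r, f s) (f ρ) ρ := by
  have h0 : (0 : ℝ) ∈ Set.Ioo (-ε) ε := ⟨by linarith [hρ.1, hρ.2], by linarith [hρ.1, hρ.2]⟩
  have hsub : Set.uIcc 0 ρ ⊆ Set.Ioo (-ε) ε := (convex_Ioo _ _).ordConnected.uIcc_subset h0 hρ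
  exact intervalIntegral.integral_hasDerivAt_right (hf.mono hsub).intervalIntegrable
    (hf.stronglyMeasurableAtFilter isOpen_Ioo ρ hρ) (hf.continuousAt (isOpen_Ioo.mem_nhds hρ))

end Integral

/-! ### Order of vanishing at `ρ = 0` -/

section Order

/-- Taylor's formula at leading order, for a function given with its successive derivatives, by
repeated use of L'Hôpital's rule. -/
lemma tendsto_inv_pow_mul (n : ℕ) : ∀ f : ℕ → ℝ → ℝ,
    (∀ k, ∀ᶠ r in 𝓝 0, HasDerivAt (f k) (f (k + 1) r) r) → (∀ k < n, f k 0 = 0) →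
    Tendsto (fun r : ℝ => (r ^ n)⁻¹ * f 0 r) (𝓝[≠] 0) (𝓝 (f n 0 / n.factorial)) := by
  induction n with
  | zero =>
    intro f hf _
    have := (hf 0).self_of_nhds.continuousAt.tendsto.mono_left (nhdsWithin_le_nhds (s := {0}ᶜ))
    simpa using this
  | succ n ih =>
    intro f hf h0
    have h1 := ih (fun k => f (k + 1)) (fun k => hf (k + 1)) (fun k hk => h0 (k + 1) (by omega))
    have h2 : Tendsto (fun r : ℝ => f 1 r / ((n + 1 : ℕ) * r ^ n)) (𝓝[≠] 0)
        (𝓝 (f (n + 1) 0 / (n + 1).factorial)) := by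
      have h3 := h1.const_mul (((n + 1 : ℕ) : ℝ)⁻¹)
      have e : ((n + 1 : ℕ) : ℝ)⁻¹ * (f (n + 1) 0 / n.factorial) =
          f (n + 1) 0 / (n + 1).factorial := by
        rw [Nat.factorial_succ, Nat.cast_mul]
        field_simp
      rw [e] at h3
      refine h3.congr fun r => ?_
      rw [div_eq_mul_inv, mul_inv]; ring
    have h4 : Tendsto (fun r => f 0 r / r ^ (n + 1)) (𝓝[≠] 0)
        (𝓝 (f (n + 1) 0 / (n + 1).factorial)) := by
      refine HasDerivAt.lhopital_zero_nhdsNE (f' := f 1)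
        (g' := fun r => (n + 1 : ℕ) * r ^ n) ((hf 0).filter_mono nhdsWithin_le_nhds) ?_ ?_ ?_ ?_ h2
      · exact Eventually.of_forall fun r => by simpa using hasDerivAt_pow (n + 1) r
      · filter_upwards [self_mem_nhdsWithin] with r hr
        exact mul_ne_zero (by positivity) (pow_ne_zero _ hr)
      · have := (hf 0).self_of_nhds.continuousAt.tendsto.mono_left
          (nhdsWithin_le_nhds (s := {0}ᶜ))
        rwa [h0 0 (by omega)] at this
      · have : Tendsto (fun r : ℝ => r ^ (n + 1)) (𝓝 0) (𝓝 (0 ^ (n + 1))) :=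
          (continuous_pow (n + 1)).tendsto 0
        rw [zero_pow (by omega)] at this
        exact this.mono_left nhdsWithin_le_nhds
    exact h4.congr fun r => by rw [div_eq_mul_inv, mul_comm]

/-- A smooth function which is `O(r^n)` has vanishing derivatives of order less than `n`: otherwise
the first nonvanishing derivative contradicts the leading order of Taylor's formula. -/
lemma eq_zero_of_tendsto {n : ℕ} {f : ℕ → ℝ → ℝ}
    (hf : ∀ k, ∀ᶠ r in 𝓝 0, HasDerivAt (f k) (f (k + 1) r) r) {L : ℝ}
    (hL : Tendsto (fun r : ℝ => (r ^ n)⁻¹ * f 0 r) (𝓝[≠] 0) (𝓝 L)) :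
    ∀ k < n, f k 0 = 0 := by
  intro k
  induction k using Nat.strong_induction_on with
  | _ k ih =>
    intro hk
    have h1 := tendsto_inv_pow_mul k f hf fun j hj => ih j hj (hj.trans hk)
    have h2 : Tendsto (fun r : ℝ => r ^ (n - k)) (𝓝[≠] 0) (𝓝 0) := by
      have : Tendsto (fun r : ℝ => r ^ (n - k)) (𝓝 0) (𝓝 (0 ^ (n - k))) :=
        (continuous_pow (n - k)).tendsto 0
      rw [zero_pow (by omega)] at this
      exact this.mono_left nhdsWithin_le_nhds
    have h3 : Tendsto (fun r : ℝ => (r ^ k)⁻¹ * f 0 r) (𝓝[≠] 0) (𝓝 (0 * L)) := by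
      refine (h2.mul hL).congr' ?_
      filter_upwards [self_mem_nhdsWithin] with r hr
      have hr' : r ≠ 0 := hr
      have e : r ^ n = r ^ (n - k) * r ^ k := by rw [← pow_add]; congr 1; omega
      rw [e]
      field_simp
    have h4 := tendsto_nhds_unique h1 h3
    rw [zero_mul, div_eq_zero_iff] at h4
    exact h4.resolve_right (by positivity)

end Order

/-! ### The ambient coordinate domain and its slice `t = 1` -/

section Slice

open TopologicalSpace (Opens)

variable {d : ℕ}

/-- The domain `t > 0`, `|ρ| < ε`, `x ∈ B` in the ambient coordinates. -/
def dom (B : Opens (Fin d → ℝ)) (ε : ℝ) : Opens (Fin d ⊕ Fin 2 → ℝ) where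
  carrier := {y | 0 < y (Sum.inr 0) ∧ y (Sum.inr 1) ∈ Set.Ioo (-ε) ε ∧
    (fun μ => y (Sum.inl μ)) ∈ B}
  is_open' := by
    refine (isOpen_lt continuous_const (continuous_apply _)).inter
      ((isOpen_Ioo.preimage (continuous_apply _)).inter (B.isOpen.preimage ?_))
    fun_prop

/-- The point with coordinates `x`, `t = 1` and `ρ`. -/
def pt (r : ℝ) (x : Fin d → ℝ) : Fin d ⊕ Fin 2 → ℝ := Sum.elim x ![1, r]

variable {B : Opens (Fin d → ℝ)} {ε : ℝ}

lemma pt_mem {r : ℝ} (hr : r ∈ Set.Ioo (-ε) ε) {x : Fin d → ℝ} (hx : x ∈ B) :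
    pt r x ∈ dom B ε := ⟨by simp [pt], by simpa [pt] using hr, by simpa [pt] using hx⟩

lemma contDiff_pt : ContDiff ℝ ∞ fun p : ℝ × (Fin d → ℝ) => pt p.1 p.2 := by
  rw [contDiff_pi]
  rintro (i | i)
  · simp only [pt, Sum.elim_inl]; fun_prop
  · fin_cases i <;> simp [pt] <;> fun_prop

lemma hasFDerivAt_pt (r : ℝ) (x : Fin d → ℝ) : HasFDerivAt (pt r)
    (ContinuousLinearMap.pi 
      (Sum.elim (fun i => ContinuousLinearMap.proj (R := ℝ) (φ := fun _ : Fin d => ℝ) i)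
        fun _ => 0)) x := by
  rw [hasFDerivAt_pi']
  rintro (i | i)
  · exact (ContinuousLinearMap.proj (R := ℝ) (φ := fun _ : Fin d => ℝ) i).hasFDerivAt
  · exact hasFDerivAt_const _ _

lemma hasDerivAt_pt (r : ℝ) (x : Fin d → ℝ) :
    HasDerivAt (fun s => pt s x) (Pi.single (Sum.inr 1) 1) r := by
  rw [hasDerivAt_pi]
  rintro (i | i)
  · simpa [pt] using hasDerivAt_const r (x i)
  · fin_cases i
    · simpa [pt] using hasDerivAt_const r (1 : ℝ)
    · simpa [pt] using hasDerivAt_id' r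

/-- The restriction of a smooth function to the slice `t = 1`. -/
def sl (a : SmoothFun (dom B ε)) (r : ℝ) (x : Fin d → ℝ) : ℝ :=
  extZ (dom B ε) a (pt r x)

lemma sl_eq_ev (a : SmoothFun (dom B ε)) {r : ℝ} (hr : r ∈ Set.Ioo (-ε) ε) {x : Fin d → ℝ}
    (hx : x ∈ B) : sl a r x = ev ⟨pt r x, pt_mem hr hx⟩ a := extZ_of_mem _ _

lemma contDiffOn_sl (a : SmoothFun (dom B ε)) :
    ContDiffOn ℝ ∞ (fun p : ℝ × (Fin d → ℝ) => sl a p.1 p.2) (Set.Ioo (-ε) ε ×ˢ (B : Set _)) :=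
  ContDiffOn.comp a.2 contDiff_pt.contDiffOn fun _ hp => pt_mem hp.1 hp.2

/-- The field `u` is the restriction of `a` to the slice `t = 1`. -/
def Rep (u : ℝ → (Fin d → ℝ) → ℝ) (a : SmoothFun (dom B ε)) : Prop :=
  ∀ r ∈ Set.Ioo (-ε) ε, ∀ x ∈ B, u r x = sl a r x

lemma Rep.pd {u : ℝ → (Fin d → ℝ) → ℝ} {a : SmoothFun (dom B ε)} (h : Rep u a) (i : Fin d) :
    Rep (fun r x => Ambient.pd i (u r) x) (partialD _ (Sum.inl i) a) := by
  intro r hr x hx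
  have e : u r =ᶠ[𝓝 x] fun y => extZ (dom B ε) a (pt r y) :=
    eventually_of_mem (B.isOpen.mem_nhds hx) fun y hy => h r hr y hy
  have hc : HasFDerivAt (fun y => extZ (dom B ε) a (pt r y)) _ x :=
    (differentiableAt_extZ a ⟨pt r x, pt_mem hr hx⟩).hasFDerivAt.comp x (hasFDerivAt_pt r x)
  rw [sl_eq_ev _ hr hx, ev_partialD]
  simp only [Ambient.pd]
  rw [e.fderiv_eq, hc.fderiv, ContinuousLinearMap.comp_apply]
  congr 1
  ext j
  rcases j with j | j
  · simp [Pi.single_apply]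
  · simp

lemma hasDerivAt_sl (a : SmoothFun (dom B ε)) {r : ℝ} (hr : r ∈ Set.Ioo (-ε) ε) {x : Fin d → ℝ}
    (hx : x ∈ B) :
    HasDerivAt (fun s => sl a s x) (sl (partialD _ (Sum.inr 1) a) r x) r := by
  rw [sl_eq_ev _ hr hx, ev_partialD]
  exact (differentiableAt_extZ a ⟨pt r x, pt_mem hr hx⟩).hasFDerivAt.comp_hasDerivAt r
    (hasDerivAt_pt r x)

lemma Rep.dRho {u : ℝ → (Fin d → ℝ) → ℝ} {a : SmoothFun (dom B ε)} (h : Rep u a) :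
    Rep (Ambient.dRho u) (partialD _ (Sum.inr 1) a) := by
  intro r hr x hx
  have e : (fun s => u s x) =ᶠ[𝓝 r] fun s => sl a s x :=
    eventually_of_mem (isOpen_Ioo.mem_nhds hr) fun s hs => h s hs x hx
  rw [Ambient.dRho, e.deriv_eq, (hasDerivAt_sl a hr hx).deriv]

/-- The smooth function on the ambient domain, independent of `t`, given by a smooth field. -/
def pull (u : ℝ → (Fin d → ℝ) → ℝ)
    (hu : ContDiffOn ℝ ∞ (fun p : ℝ × (Fin d → ℝ) => u p.1 p.2)
      (Set.Ioo (-ε) ε ×ˢ (B : Set (Fin d → ℝ)))) : SmoothFun (dom B ε) :=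
  SmoothFun.mk (fun y => u (y (Sum.inr 1)) fun μ => y (Sum.inl μ))
    (hu.comp (f := fun y : Fin d ⊕ Fin 2 → ℝ => (y (Sum.inr 1), fun μ => y (Sum.inl μ)))
      (by fun_prop) fun _ hy => ⟨hy.2.1, hy.2.2⟩)

section pull

variable {u : ℝ → (Fin d → ℝ) → ℝ}
    (hu : ContDiffOn ℝ ∞ (fun p : ℝ × (Fin d → ℝ) => u p.1 p.2)
      (Set.Ioo (-ε) ε ×ˢ (B : Set (Fin d → ℝ))))

lemma ev_pull (v : dom B ε) : ev v (pull u hu) = u (v.1 (Sum.inr 1)) fun μ => v.1 (Sum.inl μ) :=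
  rfl

lemma rep_pull : Rep u (pull u hu) := by
  intro r hr x hx
  rw [sl_eq_ev _ hr hx]
  simp [ev_pull, pt]

lemma dt_pull : partialD _ (Sum.inr 0) (pull u hu) = 0 := by
  refine SmoothFun.ext_ev fun v => ?_
  rw [← pd_eq_ev (F := fun y => u (y (Sum.inr 1)) fun μ => y (Sum.inl μ))
    (fun w => (ev_pull hu w).symm), map_zero, Ambient.pd]
  have hd : DifferentiableAt ℝ (fun y : Fin d ⊕ Fin 2 → ℝ =>
      u (y (Sum.inr 1)) fun μ => y (Sum.inl μ)) v :=
    (differentiableAt_extZ (pull u hu) v).congr_of_eventuallyEq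
      (eventually_of_mem ((dom B ε).isOpen.mem_nhds v.2) fun y hy => by
        rw [extZ_of_mem _ hy]; rfl)
  rw [← hd.lineDeriv_eq_fderiv]
  simp [lineDeriv]

end pull

/-- Smooth functions independent of `t` are determined by their restriction to `t = 1`. -/
lemma eq_of_sl_eq {a b : SmoothFun (dom B ε)} (ha : partialD _ (Sum.inr 0) a = 0)
    (hb : partialD _ (Sum.inr 0) b = 0)
    (h : ∀ r ∈ Set.Ioo (-ε) ε, ∀ x ∈ B, sl a r x = sl b r x) : a = b := by
  have key : ∀ c : SmoothFun (dom B ε), partialD _ (Sum.inr 0) c = 0 → ∀ v : dom B ε,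
      ev v c = sl c (v.1 (Sum.inr 1)) fun μ => v.1 (Sum.inl μ) := by
    intro c hc v
    -- the value is constant along the ray on which only `t` varies
    let q : ℝ → (Fin d ⊕ Fin 2 → ℝ) := fun s => Function.update v.1 (Sum.inr 0) s
    have hq : ∀ s ∈ Set.Ioi (0 : ℝ), q s ∈ dom B ε := fun s hs =>
      ⟨by simpa [q] using hs, by simpa [q] using v.2.2.1, by simpa [q] using v.2.2.2⟩
    have hder : ∀ s ∈ Set.Ioi (0 : ℝ), HasDerivAt (fun s => extZ (dom B ε) c (q s)) 0 s := by
      intro s hs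
      have h1 : HasDerivAt q (Pi.single (Sum.inr 0) 1) s := hasDerivAt_update _ _ _
      have h2 := (differentiableAt_extZ c ⟨q s, hq s hs⟩).hasFDerivAt.comp_hasDerivAt s h1
      have h3 := ev_partialD (Sum.inr 0) c ⟨q s, hq s hs⟩
      rw [hc, map_zero, Ambient.pd] at h3
      rw [← h3] at h2
      exact h2
    have hconst := isOpen_Ioi.is_const_of_deriv_eq_zero isPreconnected_Ioi
      (fun s hs => (hder s hs).differentiableAt.differentiableWithinAt)
      (fun s hs => (hder s hs).deriv) (Set.mem_Ioi.mpr v.2.1) (Set.mem_Ioi.mpr one_pos)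
    have e1 : q (v.1 (Sum.inr 0)) = v.1 := Function.update_eq_self _ _
    have e2 : q 1 = pt (v.1 (Sum.inr 1)) fun μ => v.1 (Sum.inl μ) := by
      ext j
      rcases j with j | j
      · simp [q, pt]
      · fin_cases j <;> simp [q, pt]
    rw [← extZ_eq_ev, sl, ← e2, ← hconst, e1]
  refine SmoothFun.ext_ev fun v => ?_
  rw [key a ha, key b hb]
  exact h _ v.2.2.1 _ v.2.2.2

/-- Vanishing to order `n` along `ρ = 0`, `t = 1`: the derivatives `∂_∞^k a` with `k < n` vanish
there. -/
def Ord : ℕ → SmoothFun (dom B ε) → Prop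
  | 0, _ => True
  | n + 1, a => (∀ x ∈ B, sl a 0 x = 0) ∧ Ord n (partialD _ (Sum.inr 1) a)

lemma ord_iff (n : ℕ) (a : SmoothFun (dom B ε)) :
    Ord n a ↔ ∀ k < n, ∀ x ∈ B, sl ((partialD _ (Sum.inr 1))^[k] a) 0 x = 0 := by
  induction n generalizing a with
  | zero => simp [Ord]
  | succ n ih =>
    rw [Ord, ih]
    constructor
    · rintro ⟨h0, h1⟩ (_ | k) hk
      · exact h0
      · exact h1 k (by omega)
    · exact fun h => ⟨h 0 (by omega), fun k hk => h (k + 1) (by omega)⟩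

lemma Ord.of_succ {n : ℕ} {a : SmoothFun (dom B ε)} (h : Ord (n + 1) a) : Ord n a := by
  rw [ord_iff] at h ⊢
  exact fun k hk => h k (by omega)

section

variable (hε : 0 < ε)
include hε

lemma zero_mem_Ioo : (0 : ℝ) ∈ Set.Ioo (-ε) ε := ⟨by linarith, hε⟩

lemma ord_zero (n : ℕ) : Ord n (0 : SmoothFun (dom B ε)) := by
  rw [ord_iff]
  intro k _ x hx
  have : (partialD (dom B ε) (Sum.inr 1))^[k] 0 = 0 :=
    Function.iterate_fixed (map_zero _) k
  rw [this, sl_eq_ev _ (zero_mem_Ioo hε) hx, map_zero]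

lemma Ord.add {n : ℕ} {a b : SmoothFun (dom B ε)} (ha : Ord n a) (hb : Ord n b) :
    Ord n (a + b) := by
  induction n generalizing a b with
  | zero => trivial
  | succ n ih =>
    refine ⟨fun x hx => ?_, by rw [map_add]; exact ih ha.2 hb.2⟩
    have h1 := ha.1 x hx
    have h2 := hb.1 x hx
    rw [sl_eq_ev _ (zero_mem_Ioo hε) hx] at h1 h2 ⊢
    rw [map_add, h1, h2, add_zero]

lemma Ord.mul_left {n : ℕ} {a : SmoothFun (dom B ε)} (ha : Ord n a) (b : SmoothFun (dom B ε)) :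
    Ord n (b * a) := by
  induction n generalizing a b with
  | zero => trivial
  | succ n ih =>
    refine ⟨fun x hx => ?_, ?_⟩
    · have h1 := ha.1 x hx
      rw [sl_eq_ev _ (zero_mem_Ioo hε) hx] at h1 ⊢
      rw [map_mul, h1, mul_zero]
    · rw [Derivation.leibniz, smul_eq_mul, smul_eq_mul, mul_comm a]
      exact (ih ha.2 b).add hε (ih ha.of_succ _)

lemma Ord.sub {n : ℕ} {a b : SmoothFun (dom B ε)} (ha : Ord n a) (hb : Ord n b) :
    Ord n (a - b) := by
  have := ha.add hε (hb.mul_left hε (-1))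
  have e : a + -1 * b = a - b := by ring
  rwa [e] at this

lemma Ord.sum {α : Type} (s : Finset α) {n : ℕ} {a : α → SmoothFun (dom B ε)}
    (ha : ∀ i ∈ s, Ord n (a i)) : Ord n (∑ i ∈ s, a i) :=
  Finset.sum_induction a (Ord n) (fun _ _ h1 h2 => h1.add hε h2) (ord_zero hε n) ha

/-- Derivatives along `ρ = 0` preserve the order of vanishing. -/
lemma Ord.pd {n : ℕ} {a : SmoothFun (dom B ε)} (ha : Ord n a) (i : Fin d) :
    Ord n (partialD _ (Sum.inl i) a) := by
  induction n generalizing a with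
  | zero => trivial
  | succ n ih =>
    refine ⟨fun x hx => ?_, by rw [partialD_comm]; exact ih ha.2⟩
    have h1 := Rep.pd (u := sl a) (fun _ _ _ _ => rfl) i 0 (zero_mem_Ioo hε) x hx
    rw [← h1]
    have e : sl a 0 =ᶠ[𝓝 x] fun _ => 0 :=
      eventually_of_mem (B.isOpen.mem_nhds hx) fun y hy => ha.1 y hy
    simp [Ambient.pd, e.fderiv_eq]

/-- A smooth field is `O(ρ^n)` at every point of `B` if and only if it vanishes to order `n`. -/
lemma Rep.ord_iff {n : ℕ} {u : ℝ → (Fin d → ℝ) → ℝ} {a : SmoothFun (dom B ε)} (h : Rep u a) :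
    Ord n a ↔ ∀ x ∈ B, Ambient.IsORho n u x := by
  have hf : ∀ x ∈ B, ∀ k, ∀ᶠ r in 𝓝 0,
      HasDerivAt (fun r => sl ((partialD _ (Sum.inr 1))^[k] a) r x)
        (sl ((partialD _ (Sum.inr 1))^[k + 1] a) r x) r := by
    intro x hx k
    filter_upwards [isOpen_Ioo.mem_nhds (zero_mem_Ioo hε)] with r hr
    rw [Function.iterate_succ_apply']
    exact hasDerivAt_sl _ hr hx
  have he : ∀ x ∈ B, (fun r => (r ^ n)⁻¹ * u r x) =ᶠ[𝓝[≠] 0] fun r => (r ^ n)⁻¹ * sl a r x := by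
    intro x hx
    filter_upwards [nhdsWithin_le_nhds (isOpen_Ioo.mem_nhds (zero_mem_Ioo hε))] with r hr
    rw [h r hr x hx]
  rw [DiffRing.ord_iff]
  constructor
  · intro h0 x hx
    exact ⟨_, (tendsto_inv_pow_mul n _ (hf x hx) fun k hk => h0 k hk x hx).congr' (he x hx).symm⟩
  · intro hO k hk x hx
    obtain ⟨L, hL⟩ := hO x hx
    exact eq_zero_of_tendsto (hf x hx) (hL.congr' (he x hx)) k hk

end

end Slice

/-! ### Geometric fields as elements of the ring of smooth functions -/

section Fields

open TopologicalSpace (Opens)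

variable {d : ℕ} {B : Opens (Fin d → ℝ)} {ε : ℝ}

lemma Rep.ev {u : ℝ → (Fin d → ℝ) → ℝ} {a : SmoothFun (dom B ε)} (h : Rep u a) {r : ℝ}
    (hr : r ∈ Set.Ioo (-ε) ε) {x : Fin d → ℝ} (hx : x ∈ B) :
    u r x = ev ⟨pt r x, pt_mem hr hx⟩ a := by rw [h r hr x hx, sl_eq_ev _ hr hx]

lemma rep_of_ev {u : ℝ → (Fin d → ℝ) → ℝ} {a : SmoothFun (dom B ε)}
    (h : ∀ r (hr : r ∈ Set.Ioo (-ε) ε) x (hx : x ∈ B),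
      u r x = DiffRing.ev ⟨pt r x, pt_mem hr hx⟩ a) : Rep u a :=
  fun r hr x hx => by rw [h r hr x hx, sl_eq_ev _ hr hx]

lemma Rep.contDiffOn {u : ℝ → (Fin d → ℝ) → ℝ} {a : SmoothFun (dom B ε)} (h : Rep u a) :
    ContDiffOn ℝ ∞ (fun p : ℝ × (Fin d → ℝ) => u p.1 p.2)
      (Set.Ioo (-ε) ε ×ˢ (B : Set (Fin d → ℝ))) :=
  (contDiffOn_sl a).congr fun p hp => h p.1 hp.1 p.2 hp.2

/-- The derivative `∂_∞` of a field independent of `t` is determined on the slice `t = 1`. -/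
lemma Rep.dInf_eq {u : ℝ → (Fin d → ℝ) → ℝ} {a b : SmoothFun (dom B ε)} (h : Rep u a)
    (hd : ∀ r ∈ Set.Ioo (-ε) ε, ∀ x ∈ B, HasDerivAt (fun s => u s x) (sl b r x) r)
    (ha : partialD _ (Sum.inr 0) a = 0) (hb : partialD _ (Sum.inr 0) b = 0) :
    partialD _ (Sum.inr 1) a = b := by
  refine eq_of_sl_eq (by rw [partialD_comm, ha, map_zero]) hb fun r hr x hx => ?_
  rw [← h.dRho r hr x hx, Ambient.dRho, (hd r hr x hx).deriv]

/-- The initial value of a smooth field, extended independently of `ρ`. -/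
lemma Rep.exists_initial (hε : 0 < ε) {u : ℝ → (Fin d → ℝ) → ℝ} {a : SmoothFun (dom B ε)}
    (h : Rep u a) : ∃ b : SmoothFun (dom B ε), Rep (fun _ x => u 0 x) b ∧
      partialD _ (Sum.inr 0) b = 0 ∧ partialD _ (Sum.inr 1) b = 0 := by
  have hs : ContDiffOn ℝ ∞ (fun p : ℝ × (Fin d → ℝ) => (fun _ x => u 0 x : ℝ → _ → ℝ) p.1 p.2)
      (Set.Ioo (-ε) ε ×ˢ (B : Set (Fin d → ℝ))) :=
    h.contDiffOn.comp (f := fun p : ℝ × (Fin d → ℝ) => ((0 : ℝ), p.2)) (by fun_prop)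
      fun p hp => ⟨zero_mem_Ioo hε, hp.2⟩
  refine ⟨pull _ hs, rep_pull hs, dt_pull hs, ?_⟩
  refine (rep_pull hs).dInf_eq (fun r hr x hx => ?_) (dt_pull hs) (map_zero _)
  rw [sl_eq_ev _ hr hx, map_zero]
  exact hasDerivAt_const _ _

/-- The primitive in `ρ` of a smooth field. -/
lemma Rep.exists_primitive {u : ℝ → (Fin d → ℝ) → ℝ} {a : SmoothFun (dom B ε)}
    (h : Rep u a) (ha : partialD _ (Sum.inr 0) a = 0) :
    ∃ b : SmoothFun (dom B ε), Rep (Ambient.intRho u) b ∧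
      partialD _ (Sum.inr 0) b = 0 ∧ partialD _ (Sum.inr 1) b = a := by
  have hs : ContDiffOn ℝ ∞ (fun p : ℝ × (Fin d → ℝ) => Ambient.intRho u p.1 p.2)
      (Set.Ioo (-ε) ε ×ˢ (B : Set (Fin d → ℝ))) := contDiffOn_primitive B.isOpen h.contDiffOn
  refine ⟨pull _ hs, rep_pull hs, dt_pull hs, ?_⟩
  refine (rep_pull hs).dInf_eq (fun r hr x hx => ?_) (dt_pull hs) ha
  rw [← h r hr x hx]
  refine hasDerivAt_primitive (f := fun s => u s x) ?_ hr
  exact h.contDiffOn.continuousOn.comp (f := fun s : ℝ => (s, x)) (by fun_prop) fun s hs => ⟨hs, hx⟩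

/-- A smooth family of metrics on the domain `|ρ| < ε`, `x ∈ B`. -/
structure IsMetric (B : Opens (Fin d → ℝ)) (ε : ℝ)
    (g : ℝ → (Fin d → ℝ) → Matrix (Fin d) (Fin d) ℝ) : Prop where
  smooth : ∀ μ ν, ContDiffOn ℝ ∞ (fun p : ℝ × (Fin d → ℝ) => (fun r x => g r x μ ν) p.1 p.2)
    (Set.Ioo (-ε) ε ×ˢ (B : Set (Fin d → ℝ)))
  symm : ∀ r ∈ Set.Ioo (-ε) ε, ∀ x ∈ B, (g r x).IsSymm
  det_ne : ∀ r ∈ Set.Ioo (-ε) ε, ∀ x ∈ B, (g r x).det ≠ 0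

lemma ev_partialD_coord {κ : Type} [Fintype κ] [DecidableEq κ] {V : Opens (κ → ℝ)} (i j : κ)
    (h : ContDiffOn ℝ ∞ (fun y : κ → ℝ => y j) V) :
    partialD V i (SmoothFun.mk (fun y => y j) h) = if i = j then 1 else 0 := by
  refine SmoothFun.ext_ev fun v => ?_
  rw [← pd_eq_ev (F := fun y => y j) (fun w => rfl), Ambient.pd]
  have : HasFDerivAt (fun y : κ → ℝ => y j)
      (ContinuousLinearMap.proj (R := ℝ) (φ := fun _ : κ => ℝ) j) v.1 :=
    (ContinuousLinearMap.proj (R := ℝ) (φ := fun _ : κ => ℝ) j).hasFDerivAt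
  rw [this.fderiv]
  by_cases hij : i = j
  · simp [hij]
  · simp [hij, Ne.symm hij]

namespace IsMetric

variable {g : ℝ → (Fin d → ℝ) → Matrix (Fin d) (Fin d) ℝ} (h : IsMetric B ε g)
include h

/-- The metric as a matrix over the ring of smooth functions. -/
def mat (h : IsMetric B ε g) : Matrix (Fin d) (Fin d) (SmoothFun (dom B ε)) :=
  Matrix.of fun μ ν => pull (fun r x => g r x μ ν) (h.smooth μ ν)

lemma map_mat (v : dom B ε) :
    h.mat.map (ev v) = g (v.1 (Sum.inr 1)) fun μ => v.1 (Sum.inl μ) := by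
  ext μ ν; simp [mat, ev_pull]

lemma isUnit_det : IsUnit h.mat.det := by
  refine isUnit_of_ev_ne_zero fun v => ?_
  have : ev v h.mat.det = (h.mat.map (ev v)).det := (ev v).map_det h.mat
  rw [this, h.map_mat]
  exact h.det_ne _ v.2.2.1 _ v.2.2.2

lemma map_mat_inv (v : dom B ε) :
    h.mat⁻¹.map (ev v) = (g (v.1 (Sum.inr 1)) fun μ => v.1 (Sum.inl μ))⁻¹ := by
  refine (Matrix.inv_eq_left_inv ?_).symm
  rw [← h.map_mat, ← Matrix.map_mul, Matrix.nonsing_inv_mul _ h.isUnit_det,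
    Matrix.map_one _ (map_zero _) (map_one _)]

/-- The ring of smooth functions on the ambient domain as a ring with an ambient metric. -/
def ring (h : IsMetric B ε g) : AmbientRing (SmoothFun (dom B ε)) (Fin d) where
  D := partialD _
  comm := partialD_comm
  t := SmoothFun.mk (fun y => y (Sum.inr 0)) (by fun_prop)
  τ := SmoothFun.mk (fun y => (y (Sum.inr 0))⁻¹)
    (ContDiffOn.inv (by fun_prop) fun y hy => (ne_of_gt hy.1))
  ρ := SmoothFun.mk (fun y => y (Sum.inr 1)) (by fun_prop)
  t_mul_τ := SmoothFun.ext_ev fun v => by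
    rw [map_mul, ev_mk, ev_mk, map_one]
    exact mul_inv_cancel₀ (ne_of_gt v.2.1)
  D_t_x i := by rw [ev_partialD_coord]; simp
  D_t_t := by rw [ev_partialD_coord]; simp
  D_t_ρ := by rw [ev_partialD_coord]; simp
  D_ρ_x i := by rw [ev_partialD_coord]; simp
  D_ρ_t := by rw [ev_partialD_coord]; simp
  D_ρ_ρ := by rw [ev_partialD_coord]; simp
  g := h.mat
  gi := h.mat⁻¹
  symm := by
    ext i j
    refine congrArg Subtype.val (SmoothFun.ext_ev fun v => ?_) |> fun e => congrFun e _
    exact congrFun (congrFun (h.symm _ v.2.2.1 _ v.2.2.2) i) j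
  gi_mul_g := Matrix.nonsing_inv_mul _ h.isUnit_det
  D_g_t i j := dt_pull (u := fun r x => g r x i j) (h.smooth i j)

lemma ev_h (v : dom B ε) (I J : Fin d ⊕ Fin 2) :
    Ambient.ambientMetric g v I J = ev v (h.ring.h I J) := by
  rcases I with i | i <;> rcases J with j | j
  · have := congrFun (congrFun (h.map_mat v) i) j
    simp only [Matrix.map_apply] at this
    simp only [Ambient.ambientMetric, AmbientRing.h, Matrix.fromBlocks_apply₁₁,
      Matrix.smul_apply, smul_eq_mul, map_mul, map_pow, ← this]
    rfl
  · simp [Ambient.ambientMetric, AmbientRing.h]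
  · simp [Ambient.ambientMetric, AmbientRing.h]
  · fin_cases i <;> fin_cases j <;> simp [Ambient.ambientMetric, AmbientRing.h] <;> rfl

lemma ev_hi (v : dom B ε) (I J : Fin d ⊕ Fin 2) :
    (Ambient.ambientMetric g v)⁻¹ I J = ev v (h.ring.hi I J) := by
  have e : Ambient.ambientMetric g v = h.ring.h.map (ev v) := by
    ext I J; exact h.ev_h v I J
  have : (Ambient.ambientMetric g v)⁻¹ = h.ring.hi.map (ev v) := by
    refine Matrix.inv_eq_left_inv ?_
    rw [e, ← Matrix.map_mul, h.ring.hi_mul_h, Matrix.map_one _ (map_zero _) (map_one _)]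
  rw [this, Matrix.map_apply]

lemma ev_Γh (v : dom B ε) (K I J : Fin d ⊕ Fin 2) :
    Ambient.christoffel (Ambient.ambientMetric g) K I J v = ev v (h.ring.Γh K I J) := by
  have e : ∀ M I J, Ambient.pd M (fun y => Ambient.ambientMetric g y I J) v =
      ev v (h.ring.D M (h.ring.h I J)) := fun M I J => pd_eq_ev (fun w => h.ev_h w I J) v M
  simp only [Ambient.christoffel, chr, map_mul, map_sum, map_add, map_sub, ev_half, e, h.ev_hi]

lemma ev_Sh (v : dom B ε) (I J : Fin d ⊕ Fin 2) :
    Ambient.ricci (Ambient.ambientMetric g) I J v = ev v (h.ring.Sh I J) := by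
  have e : ∀ M K I J, Ambient.pd M (Ambient.christoffel (Ambient.ambientMetric g) K I J) v =
      ev v (h.ring.D M (h.ring.Γh K I J)) :=
    fun M K I J => pd_eq_ev (fun w => h.ev_Γh w K I J) v M
  simp only [Ambient.ricci, ric, map_mul, map_sum, map_add, map_sub, e, h.ev_Γh]

lemma rep_S (I J : Fin d ⊕ Fin 2) : Rep (Ambient.ambientRicci g I J) (h.ring.Sh I J) :=
  rep_of_ev fun r hr x hx => h.ev_Sh ⟨pt r x, pt_mem hr hx⟩ I J

lemma rep_g (i j : Fin d) : Rep (fun r x => g r x i j) (h.ring.g i j) :=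
  rep_pull (u := fun r x => g r x i j) (h.smooth i j)

lemma rep_gi (i j : Fin d) : Rep (fun r x => (g r x)⁻¹ i j) (h.ring.gi i j) :=
  rep_of_ev fun r hr x hx => by
    have := congrFun (congrFun (h.map_mat_inv ⟨pt r x, pt_mem hr hx⟩) i) j
    simp only [Matrix.map_apply] at this
    exact this.symm

lemma rep_ρ : Rep (fun r _ => r) h.ring.ρ :=
  rep_of_ev fun r _ x _ => by simp [ring, ev_mk, pt]

lemma rep_Γ (k i j : Fin d) : Rep (fun r x => Ambient.christoffel (g r) k i j x)
    (h.ring.Γ k i j) := by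
  refine rep_of_ev fun r hr x hx => ?_
  have e : ∀ m i j, Ambient.pd m (fun y => g r y i j) x =
    ev _ (h.ring.d m (h.ring.g i j)) := fun m i j => ((h.rep_g i j).pd m).ev hr hx
  have e' : ∀ i j, (g r x)⁻¹ i j = ev _ (h.ring.gi i j) := fun i j => (h.rep_gi i j).ev hr hx
  simp only [Ambient.christoffel, chr, map_mul, map_sum, map_add, map_sub, ev_half, e, e']

lemma rep_ric (i j : Fin d) : Rep (fun r x => Ambient.ricci (g r) i j x)
    (ric h.ring.d h.ring.Γ i j) := by
  refine rep_of_ev fun r hr x hx => ?_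
  have e : ∀ m k i j, Ambient.pd m (Ambient.christoffel (g r) k i j) x =
    ev _ (h.ring.d m (h.ring.Γ k i j)) := fun m k i j => ((h.rep_Γ k i j).pd m).ev hr hx
  have e' : ∀ k i j, Ambient.christoffel (g r) k i j x = ev _ (h.ring.Γ k i j) :=
    fun k i j => (h.rep_Γ k i j).ev hr hx
  simp only [Ambient.ricci, ric, map_mul, map_sum, map_add, map_sub, e, e']

lemma rep_cov {w : Fin d → ℝ → (Fin d → ℝ) → ℝ} {a : Fin d → SmoothFun (dom B ε)}
    (hw : ∀ α, Rep (w α) (a α)) (i j : Fin d) :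
    Rep (fun r x => Ambient.covDeriv (g r) (fun α => w α r) i j x)
      (cov h.ring.d h.ring.Γ a i j) := by
  refine rep_of_ev fun r hr x hx => ?_
  have e : Ambient.pd i (w j r) x = ev _ (h.ring.d i (a j)) := ((hw j).pd i).ev hr hx
  have e1 : ∀ j, w j r x = ev _ (a j) := fun j => (hw j).ev hr hx
  have e' : ∀ k i j, Ambient.christoffel (g r) k i j x = ev _ (h.ring.Γ k i j) :=
    fun k i j => (h.rep_Γ k i j).ev hr hx
  simp only [Ambient.covDeriv, cov, map_mul, map_sum, map_sub, e, e1, e']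

lemma rep_boxForm {w : Fin d → ℝ → (Fin d → ℝ) → ℝ} {a : Fin d → SmoothFun (dom B ε)}
    (hw : ∀ α, Rep (w α) (a α)) (j : Fin d) :
    Rep (fun r x => Ambient.boxForm (g r) (fun α => w α r) j x)
      (∑ k, ∑ l, h.ring.gi k l * covT h.ring.d h.ring.Γ (cov h.ring.d h.ring.Γ a) k l j) := by
  refine rep_of_ev fun r hr x hx => ?_
  have e : ∀ k i j, Ambient.pd k (Ambient.covDeriv (g r) (fun α => w α r) i j) x =
      ev _ (h.ring.d k (cov h.ring.d h.ring.Γ a i j)) :=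
    fun k i j => ((h.rep_cov hw i j).pd k).ev hr hx
  have e1 : ∀ i j, Ambient.covDeriv (g r) (fun α => w α r) i j x =
      ev _ (cov h.ring.d h.ring.Γ a i j) := fun i j => (h.rep_cov hw i j).ev hr hx
  have e' : ∀ k i j, Ambient.christoffel (g r) k i j x = ev _ (h.ring.Γ k i j) :=
    fun k i j => (h.rep_Γ k i j).ev hr hx
  have e2 : ∀ i j, (g r x)⁻¹ i j = ev _ (h.ring.gi i j) := fun i j => (h.rep_gi i j).ev hr hx
  simp only [Ambient.boxForm, Ambient.covDeriv₂, covT, map_mul, map_sum, map_sub, e, e1, e', e2]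

lemma rep_boxFun {f : ℝ → (Fin d → ℝ) → ℝ} {a : SmoothFun (dom B ε)} (hf : Rep f a) :
    Rep (fun r x => Ambient.boxFun (g r) (f r) x)
      (∑ k, ∑ l, h.ring.gi k l * cov h.ring.d h.ring.Γ (fun j => h.ring.d j a) k l) := by
  refine rep_of_ev fun r hr x hx => ?_
  have e1 : ∀ i j, Ambient.covDeriv (g r) (fun α => Ambient.pd α (f r)) i j x =
      ev _ (cov h.ring.d h.ring.Γ (fun j => h.ring.d j a) i j) :=
    fun i j => (h.rep_cov (fun α => hf.pd α) i j).ev hr hx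
  have e2 : ∀ i j, (g r x)⁻¹ i j = ev _ (h.ring.gi i j) := fun i j => (h.rep_gi i j).ev hr hx
  simp only [Ambient.boxFun, map_mul, map_sum, e1, e2]

lemma rep_gPrime (i j : Fin d) : Rep (fun r x => Ambient.gPrime g r x i j)
    (h.ring.dInf (h.ring.g i j)) := (h.rep_g i j).dRho

lemma rep_trPrime : Rep (Ambient.trPrime g) h.ring.trP := by
  refine rep_of_ev fun r hr x hx => ?_
  have e1 : ∀ i j, Ambient.gPrime g r x i j = ev _ (h.ring.dInf (h.ring.g i j)) :=
    fun i j => (h.rep_gPrime i j).ev hr hx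
  have e2 : ∀ i j, (g r x)⁻¹ i j = ev _ (h.ring.gi i j) := fun i j => (h.rep_gi i j).ev hr hx
  simp only [Ambient.trPrime, AmbientRing.trP, map_mul, map_sum, e1, e2]

lemma rep_gPrimeUp (i j : Fin d) : Rep (Ambient.gPrimeUp g i j) (h.ring.gPUp i j) := by
  refine rep_of_ev fun r hr x hx => ?_
  have e1 : ∀ i j, Ambient.gPrime g r x i j = ev _ (h.ring.dInf (h.ring.g i j)) :=
    fun i j => (h.rep_gPrime i j).ev hr hx
  have e2 : ∀ i j, (g r x)⁻¹ i j = ev _ (h.ring.gi i j) := fun i j => (h.rep_gi i j).ev hr hx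
  simp only [Ambient.gPrimeUp, AmbientRing.gPUp, map_mul, map_sum, e1, e2]

lemma rep_Q (i : Fin d) : Rep (Ambient.Q g i) (h.ring.Qv i) := by
  refine Rep.dRho (rep_of_ev fun r hr x hx => ?_)
  have e' : ∀ k i j, Ambient.christoffel (g r) k i j x = ev _ (h.ring.Γ k i j) :=
    fun k i j => (h.rep_Γ k i j).ev hr hx
  have e2 : ∀ i j, (g r x)⁻¹ i j = ev _ (h.ring.gi i j) := fun i j => (h.rep_gi i j).ev hr hx
  simp only [map_mul, map_sum, e', e2]

lemma exists_rep_gaugeF (i : Fin d) : ∃ a : SmoothFun (dom B ε), Rep (Ambient.gaugeF g i) a := by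
  refine ⟨∑ k, ∑ l, h.ring.gi k l *
      (h.ring.d k (h.ring.g l i) - half _ * h.ring.d i (h.ring.g k l)),
    rep_of_ev fun r hr x hx => ?_⟩
  have e : ∀ m i j, Ambient.pd m (fun y => g r y i j) x =
    ev _ (h.ring.d m (h.ring.g i j)) := fun m i j => ((h.rep_g i j).pd m).ev hr hx
  have e2 : ∀ i j, (g r x)⁻¹ i j = ev _ (h.ring.gi i j) := fun i j => (h.rep_gi i j).ev hr hx
  simp only [Ambient.gaugeF, map_mul, map_sum, map_sub, ev_half, e, e2]

/-- The field `γ` is smooth, and `∂_∞ γ = S_{∞∞}`. -/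
lemma exists_rep_gaugeGamma (hε : 0 < ε) : ∃ γ : SmoothFun (dom B ε),
    Rep (Ambient.gaugeGamma g) γ ∧ h.ring.dt γ = 0 ∧
      h.ring.dInf γ = h.ring.Sh (Sum.inr 1) (Sum.inr 1) := by
  obtain ⟨a, ha, ha0, ha1⟩ := h.rep_trPrime.exists_initial hε
  obtain ⟨b, hb, hb0, hb1⟩ := (h.rep_S (Sum.inr 1) (Sum.inr 1)).exists_primitive h.ring.dt_Sh_ρ_ρ
  refine ⟨-(half _ * a) + b, rep_of_ev fun r hr x hx => ?_, ?_, ?_⟩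
  · have e1 := ha.ev hr hx
    have e2 : Ambient.intRho (Ambient.Sinfinf g) r x = _ := hb.ev hr hx
    rw [Ambient.gaugeGamma, e1, e2, map_add, map_neg, map_mul, ev_half, neg_mul]
  · rw [map_add, map_neg, derivation_half_mul]
    simp [ring, ha0, hb0]
  · rw [map_add, map_neg, derivation_half_mul]
    have e1 : h.ring.dInf a = 0 := ha1
    have e2 : h.ring.dInf b = h.ring.Sh (Sum.inr 1) (Sum.inr 1) := hb1
    rw [e1, e2]; simp

/-- The field `G_i` is smooth, and `∂_∞ G_i = 2 S_{i∞} - ∂_i γ`. -/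
lemma exists_rep_gaugeG (hε : 0 < ε) {γ : SmoothFun (dom B ε)}
    (hγ : Rep (Ambient.gaugeGamma g) γ) (hγ0 : h.ring.dt γ = 0) (i : Fin d) :
    ∃ G : SmoothFun (dom B ε), Rep (Ambient.gaugeG g i) G ∧
      h.ring.dInf G = 2 * h.ring.Sh (Sum.inl i) (Sum.inr 1) - h.ring.d i γ := by
  obtain ⟨f, hf⟩ := h.exists_rep_gaugeF i
  obtain ⟨a, ha, ha0, ha1⟩ := hf.exists_initial hε
  obtain ⟨b, hb, hb0, hb1⟩ := (h.rep_S (Sum.inl i) (Sum.inr 1)).exists_primitive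
    (by rw [h.ring.Sh_symm]; exact h.ring.dt_Sh_ρ_x i)
  obtain ⟨c, hc, hc0, hc1⟩ := hγ.exists_primitive hγ0
  refine ⟨a + 2 * b - h.ring.d i c, rep_of_ev fun r hr x hx => ?_, ?_⟩
  · have e1 := ha.ev hr hx
    have e2 : Ambient.intRho (Ambient.Sinf g i) r x = _ := hb.ev hr hx
    have e3 : Ambient.pd i (Ambient.intRho (Ambient.gaugeGamma g) r) x =
      ev _ (h.ring.d i c) := (hc.pd i).ev hr hx
    rw [Ambient.gaugeG, e1, e2, e3, map_sub, map_add, map_mul, map_ofNat]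
  · have e1 : h.ring.dInf a = 0 := ha1
    have e2 : h.ring.dInf b = h.ring.Sh (Sum.inl i) (Sum.inr 1) := hb1
    have e3 : h.ring.dInf c = γ := hc1
    rw [map_sub, map_add, Derivation.leibniz, e1, e2, h.ring.comm, e3]
    simp

section gauge

variable {G : Fin d → SmoothFun (dom B ε)} {γ : SmoothFun (dom B ε)}
  (hG : ∀ i, Rep (Ambient.gaugeG g i) (G i)) (hγ : Rep (Ambient.gaugeGamma g) γ)
include hG hγ

lemma rep_E (i j : Fin d) : Rep (Ambient.E g i j) (h.ring.Er G γ i j) := by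
  refine rep_of_ev fun r hr x hx => ?_
  have e1 : Ambient.S g i j r x = _ := (h.rep_S (Sum.inl i) (Sum.inl j)).ev hr hx
  have e2 : ∀ i j, Ambient.covDeriv (g r) (fun α => Ambient.gaugeG g α r) i j x =
      ev _ (cov h.ring.d h.ring.Γ G i j) := fun i j => (h.rep_cov hG i j).ev hr hx
  have e3 : g r x i j = ev _ (h.ring.g i j) := (h.rep_g i j).ev hr hx
  rw [Ambient.E, e1, e2, e2, e3, hγ.ev hr hx]
  simp only [AmbientRing.Er, map_mul, map_add, map_sub, ev_half]

lemma rep_B₁ (i : Fin d) :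
    Rep (Ambient.B₁ g (Ambient.gaugeG g) (Ambient.gaugeGamma g) i) (h.ring.B1 G γ i) := by
  refine rep_of_ev fun r hr x hx => ?_
  have e1 : Ambient.boxForm (g r) (fun α => Ambient.gaugeG g α r) i x = _ :=
    (h.rep_boxForm hG i).ev hr hx
  have e2 : ∀ i j, Ambient.ricci (g r) i j x = _ := fun i j => (h.rep_ric i j).ev hr hx
  have e3 : ∀ i j, (g r x)⁻¹ i j = ev _ (h.ring.gi i j) := fun i j => (h.rep_gi i j).ev hr hx
  have e4 : ∀ i, Ambient.gaugeG g i r x = ev _ (G i) := fun i => (hG i).ev hr hx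
  have e5 : Ambient.dRho (Ambient.gaugeG g i) r x = ev _ (h.ring.dInf (G i)) :=
    (hG i).dRho.ev hr hx
  have e6 : Ambient.dRho (Ambient.dRho (Ambient.gaugeG g i)) r x =
    ev _ (h.ring.dInf (h.ring.dInf (G i))) := (hG i).dRho.dRho.ev hr hx
  have e7 : Ambient.pd i (Ambient.gaugeGamma g r) x = ev _ (h.ring.d i γ) := (hγ.pd i).ev hr hx
  have e8 : r = ev _ h.ring.ρ := h.rep_ρ.ev hr hx
  rw [Ambient.B₁, e1, e5, e6, e7, h.rep_trPrime.ev hr hx]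
  simp only [e2, e3, e4, AmbientRing.B1, map_sub, map_add, map_mul, map_neg, map_sum, ev_half,
    map_one, map_natCast, Fintype.card_fin, ← e8]
  ring

lemma rep_B₂ :
    Rep (Ambient.B₂ g (Ambient.gaugeG g) (Ambient.gaugeGamma g)) (h.ring.B2 G γ) := by
  refine rep_of_ev fun r hr x hx => ?_
  have e1 : Ambient.boxFun (g r) (Ambient.gaugeGamma g r) x = _ := (h.rep_boxFun hγ).ev hr hx
  have e2 : ∀ i, Ambient.Q g i r x = _ := fun i => (h.rep_Q i).ev hr hx
  have e3 : ∀ i j, Ambient.gPrimeUp g i j r x = _ := fun i j => (h.rep_gPrimeUp i j).ev hr hx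
  have e4 : ∀ i, Ambient.gaugeG g i r x = ev _ (G i) := fun i => (hG i).ev hr hx
  have e5 : Ambient.dRho (Ambient.gaugeGamma g) r x = ev _ (h.ring.dInf γ) := hγ.dRho.ev hr hx
  have e6 : Ambient.dRho (Ambient.dRho (Ambient.gaugeGamma g)) r x =
    ev _ (h.ring.dInf (h.ring.dInf γ)) := hγ.dRho.dRho.ev hr hx
  have e7 : ∀ i j, Ambient.pd i (Ambient.gaugeG g j r) x = ev _ (h.ring.d i (G j)) :=
    fun i j => ((hG j).pd i).ev hr hx
  have e8 : r = ev _ h.ring.ρ := h.rep_ρ.ev hr hx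
  have e9 : ∀ i j, Ambient.covDeriv (g r) (fun α => Ambient.gaugeG g α r) i j x =
      ev _ (cov h.ring.d h.ring.Γ G i j) := fun i j => (h.rep_cov hG i j).ev hr hx
  rw [Ambient.B₂, e1, e5, e6, h.rep_trPrime.ev hr hx, hγ.ev hr hx]
  simp only [e2, e3, e4, e7, e9, AmbientRing.B2, map_sub, map_add, map_mul, map_neg, map_sum,
    ev_half, map_ofNat, map_natCast, Fintype.card_fin, ← e8]
  ring

end gauge

end IsMetric

end Fields

end DiffRing

end

theorem mainTheorem11 (d : ℕ) (hd : Even d) (hd4 : 4 ≤ d)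
    (W : Set (ℝ × (Fin d → ℝ))) (hW : IsOpen W)
    (g : ℝ → (Fin d → ℝ) → Matrix (Fin d) (Fin d) ℝ)
    (hsmooth : ∀ μ ν, ContDiffOn ℝ ∞ (fun p : ℝ × (Fin d → ℝ) => g p.1 p.2 μ ν) W)
    (hsymm : ∀ p ∈ W, (g p.1 p.2).IsSymm)
    (hnondeg : ∀ p ∈ W, (g p.1 p.2).det ≠ 0)
    (hE : ∀ x, ((0 : ℝ), x) ∈ W → ∀ μ ν, Ambient.IsORho (d / 2) (Ambient.E g μ ν) x) :
    ∀ x, ((0 : ℝ), x) ∈ W →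
      (∀ μ, Ambient.IsORho (d / 2)
        (Ambient.B₁ g (Ambient.gaugeG g) (Ambient.gaugeGamma g) μ) x) ∧
      Ambient.IsORho (d / 2 - 1)
        (Ambient.B₂ g (Ambient.gaugeG g) (Ambient.gaugeGamma g)) x := by
  intro x hx
  obtain ⟨ε, hε, hball⟩ := Metric.isOpen_iff.mp hW _ hx
  let B : TopologicalSpace.Opens (Fin d → ℝ) := ⟨Metric.ball x ε, Metric.isOpen_ball⟩
  have hxB : x ∈ B := Metric.mem_ball_self hε
  have hsub : ∀ r ∈ Set.Ioo (-ε) ε, ∀ y ∈ B, (r, y) ∈ W := by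
    intro r hr y hy
    refine hball ?_
    rw [← ball_prod_same]
    exact ⟨by rw [Real.ball_eq_Ioo]; simpa using hr, hy⟩
  have h : DiffRing.IsMetric B ε g :=
    { smooth := fun μ ν => (hsmooth μ ν).mono fun p hp => hsub p.1 hp.1 p.2 hp.2
      symm := fun r hr y hy => hsymm _ (hsub r hr y hy)
      det_ne := fun r hr y hy => hnondeg _ (hsub r hr y hy) }
  -- on the product domain all fields are smooth, so they are elements of the ring
  obtain ⟨γ, hγ, hγ0, hγ1⟩ := h.exists_rep_gaugeGamma hε
  choose G hG hG1 using fun i => h.exists_rep_gaugeG hε hγ hγ0 i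
  have hEr : ∀ i j, DiffRing.Ord (d / 2) (h.ring.Er G γ i j) := fun i j =>
    ((h.rep_E hG hγ i j).ord_iff hε).mpr fun y hy =>
      hE y (hsub 0 (DiffRing.zero_mem_Ioo hε) y hy) i j
  have htr : DiffRing.Ord (d / 2) (h.ring.trE G γ) :=
    .sum hε _ fun _ _ => .sum hε _ fun _ _ => (hEr _ _).mul_left hε _
  have hmix : ∀ j k, DiffRing.Ord (d / 2) (∑ l, h.ring.gi j l * h.ring.Er G γ l k) :=
    fun _ _ => .sum hε _ fun _ _ => (hEr _ _).mul_left hε _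
  refine ⟨fun i => ((h.rep_B₁ hG hγ i).ord_iff hε).mp ?_ x hxB,
    ((h.rep_B₂ hG hγ).ord_iff hε).mp ?_ x hxB⟩
  · rw [h.ring.B1_eq hγ1 hG1]
    refine .sub hε (.sub hε (.add hε ?_ ?_) ?_) ((htr.pd hε i).mul_left hε _)
    · exact .sum hε _ fun j _ => (hmix j i).pd hε j
    · exact .sum hε _ fun _ _ => .sum hε _ fun _ _ => (hmix _ _).mul_left hε _
    · exact .sum hε _ fun _ _ => .sum hε _ fun _ _ => (hmix _ _).mul_left hε _
  · rw [h.ring.B2_eq hγ1 hG1]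
    -- one order is lost to the derivative `∂_∞` of the trace; `d / 2` is positive
    have hn : d / 2 = d / 2 - 1 + 1 := by omega
    rw [hn] at htr hEr
    refine .sub hε (htr.2.mul_left hε _) (.mul_left hε (.sum hε _ fun i _ => .sum hε _ fun j _ =>
      (hEr i j).of_succ.mul_left hε _) _)
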